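/- Let $n\ge 1$ and let $F:\Sigma\to\mathbb{C}^n$ be a smooth Lagrangian immersion of a non-empty smooth $n$-dimensional manifold $\Sigma$ (that is, $F^*\omega=0$ for the standard Kähler form $\omega$ of $\mathbb{C}^n$), equipped with the induced Riemannian metric, which is assumed to be complete, and the induced area measure $\mu$. Let $H$ denote the mean curvature vector (the trace of the second fundamental form) of $\Sigma$ in $\mathbb{C}^n=\mathbb{R}^{2n}$. Suppose that (i) $\Sigma$ is a translating soliton: there is a constant vector $T\in\mathbb{C}^n$ with $|T|=1$ such that $T^{\perp}=H$ everywhere on $\Sigma$, where $T^\perp$ is the component of $T$ normal to $\Sigma$; (ii) $\Sigma$ has zero Maslov class: the Lagrangian angle is single valued, i.e. there are an orientation of $\Sigma$ and a continuous function $\theta:\Sigma\to\mathbb{R}$ with $dz_1\wedge\cdots\wedge dz_n|_\Sigma=e^{i\theta}\,d\mu_\Sigma$, where $d\mu_\Sigma$ is the induced volume form; (iii) $\Sigma$ has Euclidean area growth: there is a constant $C$ such that $\mu\big(F^{-1}(B(R))\big)\le C R^{n}$ for all $R\ge 1$, where $B(R)$ is the ball of radius $R$ about the origin of $\mathbb{C}^n$.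 Then $$\inf_{\Sigma}|H|^{2}=0 .$$ -/

import Mathlib

open Bundle
open scoped Manifold ContDiff

noncomputable section

namespace LagTranslator

/-- `ℂⁿ` with its Hermitian structure.  The real part `inner ℝ` of the Hermitian product is the
Euclidean metric of `ℝ²ⁿ`. -/
abbrev CSpace (n : ℕ) := EuclideanSpace ℂ (Fin n)

/-- The coordinate space `ℝⁿ`. -/
abbrev RSpace (n : ℕ) := EuclideanSpace ℝ (Fin n)

/-- The Kähler form `ω(v, w) = ⟨J v, w⟩` of `ℂⁿ`, where `J` is multiplication by `i`. -/
def kahlerForm {n : ℕ} (v w : CSpace n) : ℝ := inner ℝ (Complex.I • v) w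

/-- The holomorphic volume form `Ω = dz₁ ∧ ⋯ ∧ dzₙ` of `ℂⁿ`. -/
def holVolume {n : ℕ} (v : Fin n → CSpace n) : ℂ := Matrix.det (Matrix.of fun i j => v j i)

section Immersion

variable {n : ℕ} {M : Type*} [TopologicalSpace M] [ChartedSpace (RSpace n) M]

/-- The differential `dF_x : T_x M → ℂⁿ` of a map `F : M → ℂⁿ`. -/
def differential (F : M → CSpace n) (x : M) : TangentSpace (𝓡 n) x →L[ℝ] CSpace n :=
  mfderiv (𝓡 n) 𝓘(ℝ, CSpace n) F x

/-- The tangent plane `dF_x(T_x M) ⊆ ℂⁿ`, a real subspace. -/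
def tangentPlane (F : M → CSpace n) (x : M) : Submodule ℝ (CSpace n) :=
  LinearMap.range (differential F x).toLinearMap

/-- The component `w^⊥` of `w` normal to the tangent plane at `x`. -/
def normalPart (F : M → CSpace n) (x : M) (w : CSpace n) : CSpace n :=
  (tangentPlane F x)ᗮ.starProjection w

/-- The expression of `F` in the preferred chart `φ` at `x`, namely `F ∘ φ⁻¹ : ℝⁿ → ℂⁿ`
(meaningful on the open set `φ.target`). -/
def inChart (F : M → CSpace n) (x : M) : RSpace n → CSpace n :=
  F ∘ (extChartAt (𝓡 n) x).symm

/-- The coefficients `g_ij = ⟨∂_i F, ∂_j F⟩` of the induced metric in the preferred chart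
at `x`, at the point of coordinates `y`. -/
def gram (F : M → CSpace n) (x : M) (y : RSpace n) : Matrix (Fin n) (Fin n) ℝ :=
  Matrix.of fun i j =>
    inner ℝ (fderiv ℝ (inChart F x) y (EuclideanSpace.single i 1))
      (fderiv ℝ (inChart F x) y (EuclideanSpace.single j 1))

/-- The coefficients `A(∂_i, ∂_j) = (∂_i ∂_j F)^⊥` at `x` of the second fundamental form, in the
preferred chart at `x`. -/
def secondFundamentalForm (F : M → CSpace n) (x : M) (i j : Fin n) : CSpace n :=
  normalPart F x
    (fderiv ℝ (fderiv ℝ (inChart F x)) (extChartAt (𝓡 n) x x)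
      (EuclideanSpace.single i 1) (EuclideanSpace.single j 1))

/-- The mean curvature vector `H = g^{ij} A(∂_i, ∂_j)`, the trace of the second fundamental form
with respect to the induced metric. -/
def meanCurvature (F : M → CSpace n) (x : M) : CSpace n :=
  ∑ i, ∑ j, (gram F x (extChartAt (𝓡 n) x x))⁻¹ i j • secondFundamentalForm F x i j

/-- The measure `√(det g) dy` of the domain of the preferred chart at `x`, extended by zero
to `M`. -/
def chartArea [MeasurableSpace M] (F : M → CSpace n) (x : M) : MeasureTheory.Measure M :=
  ((MeasureTheory.volume.restrict (extChartAt (𝓡 n) x).target).withDensity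
    (fun y => ENNReal.ofReal (Real.sqrt (gram F x y).det))).map (extChartAt (𝓡 n) x).symm

/-- The area measure `dμ` on `M` induced by `F`: the measure given by `√(det g) dy` in every chart.
The measures `chartArea F x` agree on the overlaps of the chart domains, and the measure
glued from them is their least upper bound in the lattice of measures on `M`. -/
def areaMeasure [MeasurableSpace M] (F : M → CSpace n) : MeasureTheory.Measure M :=
  ⨆ x : M, chartArea F x

/-- Euclidean area growth: `μ(Σ ∩ B(R)) ≤ C Rⁿ` for all `R ≥ 1`, where `B(R)` is the ball of
`ℂⁿ` of radius `R` centred at the origin (and the area of an immersed submanifold is counted with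
multiplicity). -/
def EuclideanAreaGrowth [MeasurableSpace M] (F : M → CSpace n) : Prop :=
  ∃ C : ℝ, ∀ R : ℝ, 1 ≤ R →
    areaMeasure F (F ⁻¹' Metric.ball 0 R) ≤ ENNReal.ofReal (C * R ^ n)

/-- `F` is Lagrangian: the Kähler form vanishes on all tangent planes (which have half of the
dimension of the ambient space if `F` is an immersion). -/
def IsLagrangian (F : M → CSpace n) : Prop :=
  ∀ (x : M) (v w : TangentSpace (𝓡 n) x), kahlerForm (differential F x v) (differential F x w) = 0

/-- `F` is a translating soliton: `T^⊥ = H` for some constant unit vector `T`. -/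
def IsTranslatingSoliton (F : M → CSpace n) : Prop :=
  ∃ T : CSpace n, ‖T‖ = 1 ∧ ∀ x : M, normalPart F x T = meanCurvature F x

instance finrank_tangentSpace (x : M) :
    Fact (Module.finrank ℝ (TangentSpace (𝓡 n) x) = n) :=
  ⟨finrank_euclideanSpace_fin⟩

variable [RiemannianBundle (fun x : M => TangentSpace (𝓡 n) x)]

/-- `F : M → ℂⁿ` is a smooth isometric immersion of the Riemannian manifold `M`, that is, the metric
of `M` is the one induced by `F`. -/
structure IsIsometricImmersion (F : M → CSpace n) : Prop where
  smooth : ContMDiff (𝓡 n) 𝓘(ℝ, CSpace n) ∞ F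
  isometric : ∀ (x : M) (v w : TangentSpace (𝓡 n) x),
    inner ℝ (differential F x v) (differential F x w) = inner ℝ v w

/-- Zero Maslov class: the Lagrangian angle is single valued, i.e. `Ω|_Σ = e^{iθ} dμ_Σ` for a
continuous function `θ : M → ℝ`, where `dμ_Σ` is the volume form of the induced metric and of an
orientation `o` of the tangent spaces.  (Since `Ω` and `θ` are continuous, so is `o`, and `θ` is as
smooth as `F` allows.) -/
def ZeroMaslovClass (F : M → CSpace n) : Prop :=
  ∃ (o : ∀ x : M, Orientation ℝ (TangentSpace (𝓡 n) x) (Fin n)) (θ : M → ℝ), Continuous θ ∧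
    ∀ (x : M) (v : Fin n → TangentSpace (𝓡 n) x),
      holVolume (fun i => differential F x (v i)) =
        Complex.exp (Complex.I * (θ x : ℂ)) * (((o x).volumeForm v : ℝ) : ℂ)

end Immersion

end LagTranslator

end

/-! On a translating soliton the tangential part `X` of the constant vector `T` satisfies `div X =
|H|²`. Indeed, the second derivatives of `F` contribute to `div X` only through their trace paired
with `T^⊥`. That pairing is `⟨H, T^⊥⟩`, and the soliton equation `T^⊥ = H` turns it into `|H|²`.
Moreover `|X| ≤ |T| = 1`. Testing against a compactly supported `L`-Lipschitz function `φ` therefore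
gives `∫ φ |H|² = -∫ dφ(X) ≤ L · μ(supp φ)`, which is `integral_mul_norm_meanCurvature_sq_le`.

Suppose now that `|H|² ≥ δ > 0`. Take `φ = 1` on a geodesic ball of radius `r`, decaying to zero
over a collar of width `2/δ`, so that `L = δ/2`. Then `δ μ(B_r) ≤ (δ/2) μ(B_{r+2/δ})`: the area
doubles each time the radius grows by the fixed amount `2/δ` (`two_mul_area_closedEBall_le`), hence
grows exponentially. An isometric immersion does not increase distances (`lipschitzWith_one`), so
geodesic balls lie over Euclidean balls of comparable radius, and the area hypothesis bounds their
area by a polynomial. This is a contradiction.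

Completeness enters through Hopf–Rinow (`isCompact_closedEBall`), which makes the cutoffs compactly
supported. They are merely Lipschitz, so integration by parts relies on Rademacher's theorem. It is
carried out in charts (`integral_mul_divergence`, `integral_mul_le_of_chart`) and glued by a smooth
partition of unity. The chart independence of `H` and of the area measure makes the local
computations fit together. -/

noncomputable section

namespace LagTranslator

set_option linter.unusedSectionVars false

open MeasureTheory

/-! ### Gram matrices, tangential projection and metric traces in coordinates. -/

section LinearAlgebra

variable {n : ℕ} {E : Type*} [NormedAddCommGroup E] [InnerProductSpace ℝ E]

/-- The `i`-th standard basis vector of `ℝⁿ`. -/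
abbrev stdVec (i : Fin n) : RSpace n := EuclideanSpace.single i 1

theorem sum_smul_stdVec (w : RSpace n) : ∑ i, w i • (stdVec i : RSpace n) = w := by
  ext j
  simp [Finset.sum_apply, Pi.single_apply]

theorem map_eq_sum_stdVec {V : Type*} [AddCommGroup V] [Module ℝ V] [TopologicalSpace V]
    (D : RSpace n →L[ℝ] V) (w : RSpace n) : D w = ∑ i, w i • D (stdVec i) := by
  conv_lhs => rw [← sum_smul_stdVec w]
  simp

/-- The Gram matrix of the images of the standard basis vectors under a linear map. -/
def gramMatrix (D : RSpace n →L[ℝ] E) : Matrix (Fin n) (Fin n) ℝ :=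
  Matrix.of fun i j => inner ℝ (D (stdVec i)) (D (stdVec j))

theorem gramMatrix_apply (D : RSpace n →L[ℝ] E) (i j : Fin n) :
    gramMatrix D i j = inner ℝ (D (stdVec i)) (D (stdVec j)) := rfl

theorem gramMatrix_symm (D : RSpace n →L[ℝ] E) : (gramMatrix D).transpose = gramMatrix D := by
  ext i j
  simp [gramMatrix_apply, real_inner_comm]

theorem dotProduct_gramMatrix_mulVec (D : RSpace n →L[ℝ] E) (w w' : RSpace n) :
    w.ofLp ⬝ᵥ (gramMatrix D).mulVec w'.ofLp = inner ℝ (D w) (D w') := by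
  rw [map_eq_sum_stdVec D w, map_eq_sum_stdVec D w', sum_inner]
  simp only [dotProduct, Matrix.mulVec, gramMatrix_apply, inner_sum, real_inner_smul_left,
    real_inner_smul_right]
  refine Finset.sum_congr rfl fun i _ => ?_
  rw [Finset.mul_sum]
  refine Finset.sum_congr rfl fun j _ => ?_
  ring

theorem gramMatrix_posDef {D : RSpace n →L[ℝ] E} (hD : Function.Injective D) :
    (gramMatrix D).PosDef := by
  refine Matrix.PosDef.of_dotProduct_mulVec_pos ?_ fun {w} hw => ?_
  · ext i j
    simp [gramMatrix_apply, real_inner_comm]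
  · have h := dotProduct_gramMatrix_mulVec D (WithLp.toLp 2 w) (WithLp.toLp 2 w)
    simp only [star_trivial] at *
    rw [h]
    refine real_inner_self_pos.2 fun h0 => hw ?_
    have := hD (h0.trans (map_zero D).symm)
    simpa using congrArg WithLp.ofLp this

theorem gramMatrix_det_pos {D : RSpace n →L[ℝ] E} (hD : Function.Injective D) :
    0 < (gramMatrix D).det := (gramMatrix_posDef hD).det_pos

theorem isUnit_gramMatrix_det {D : RSpace n →L[ℝ] E} (hD : Function.Injective D) :
    IsUnit (gramMatrix D).det := (gramMatrix_det_pos hD).ne'.isUnit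

/-- The coefficients with respect to the standard basis of the orthogonal projection of `T` to the
range of an injective linear map. -/
def tangentCoeff (D : RSpace n →L[ℝ] E) (T : E) : RSpace n :=
  WithLp.toLp 2 ((gramMatrix D)⁻¹.mulVec fun i => inner ℝ (D (stdVec i)) T)

theorem tangentCoeff_apply (D : RSpace n →L[ℝ] E) (T : E) (k : Fin n) :
    tangentCoeff D T k = ∑ i, (gramMatrix D)⁻¹ k i * inner ℝ (D (stdVec i)) T := rfl

theorem inner_map_tangentCoeff {D : RSpace n →L[ℝ] E} (hD : Function.Injective D) (T : E)
    (w : RSpace n) : inner ℝ (D w) (D (tangentCoeff D T)) = inner ℝ (D w) T := by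
  rw [← dotProduct_gramMatrix_mulVec]
  simp only [tangentCoeff, Matrix.mulVec_mulVec]
  rw [Matrix.mul_nonsing_inv _ (isUnit_gramMatrix_det hD), Matrix.one_mulVec,
    map_eq_sum_stdVec D w, sum_inner]
  simp [dotProduct, real_inner_smul_left]

theorem sub_map_tangentCoeff_mem_orthogonal {D : RSpace n →L[ℝ] E} (hD : Function.Injective D)
    (T : E) : T - D (tangentCoeff D T) ∈ (LinearMap.range D.toLinearMap)ᗮ := by
  rw [Submodule.mem_orthogonal]
  rintro _ ⟨w, rfl⟩
  simp only [ContinuousLinearMap.coe_coe]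
  rw [inner_sub_right, inner_map_tangentCoeff hD, sub_self]

theorem map_tangentCoeff [FiniteDimensional ℝ E] {D : RSpace n →L[ℝ] E}
    (hD : Function.Injective D) (T : E) :
    D (tangentCoeff D T) = (LinearMap.range D.toLinearMap).starProjection T :=
  (Submodule.eq_starProjection_of_mem_of_inner_eq_zero (LinearMap.mem_range_self D.toLinearMap _) fun w hw => by
    rw [real_inner_comm]
    exact (Submodule.mem_orthogonal _ _).1 (sub_map_tangentCoeff_mem_orthogonal hD T) w hw).symm

theorem starProjection_orthogonal_range [FiniteDimensional ℝ E] {D : RSpace n →L[ℝ] E}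
    (hD : Function.Injective D) (T : E) :
    (LinearMap.range D.toLinearMap)ᗮ.starProjection T = T - D (tangentCoeff D T) := by
  rw [map_tangentCoeff hD]
  simp [Submodule.starProjection_orthogonal]

/-- The matrix of a linear endomorphism of `ℝⁿ` in the standard basis. -/
def stdMatrix (J : RSpace n →L[ℝ] RSpace n) : Matrix (Fin n) (Fin n) ℝ :=
  Matrix.of fun i j => J (stdVec j) i

theorem det_stdMatrix (J : RSpace n →L[ℝ] RSpace n) : (stdMatrix J).det = J.det := by
  have : stdMatrix J = LinearMap.toMatrix (EuclideanSpace.basisFun (Fin n) ℝ).toBasis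
      (EuclideanSpace.basisFun (Fin n) ℝ).toBasis J.toLinearMap := by
    ext i j
    simp [stdMatrix, LinearMap.toMatrix_apply]
  rw [this, LinearMap.det_toMatrix, ContinuousLinearMap.det]

theorem gramMatrix_comp (D : RSpace n →L[ℝ] E) (J : RSpace n →L[ℝ] RSpace n) :
    gramMatrix (D.comp J) = (stdMatrix J).transpose * gramMatrix D * stdMatrix J := by
  ext i j
  rw [gramMatrix_apply, ContinuousLinearMap.comp_apply, ContinuousLinearMap.comp_apply,
    ← dotProduct_gramMatrix_mulVec, Matrix.mul_assoc, Matrix.mul_apply]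
  simp [dotProduct, Matrix.mulVec, Matrix.mul_apply, stdMatrix]

/-- The Gram matrix becomes `Jᵗ G J`. The factor `|det J|` is the one in the change of variables
formula, which makes the area density independent of the chart. -/
theorem sqrt_det_gramMatrix_comp (D : RSpace n →L[ℝ] E) (J : RSpace n →L[ℝ] RSpace n) :
    √(gramMatrix (D.comp J)).det = |J.det| * √(gramMatrix D).det := by
  rw [gramMatrix_comp, Matrix.det_mul, Matrix.det_mul, Matrix.det_transpose, det_stdMatrix,
    mul_right_comm, ← pow_two, Real.sqrt_mul (sq_nonneg _), Real.sqrt_sq_eq_abs]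

/-- The trace of a bilinear map with respect to the metric induced by `D`. -/
def metricTrace (D : RSpace n →L[ℝ] E) (B : RSpace n →L[ℝ] RSpace n →L[ℝ] E) : E :=
  ∑ i, ∑ j, (gramMatrix D)⁻¹ i j • B (stdVec i) (stdVec j)

/-- Since `G` becomes `Jᵗ G J`, one has `J (Jᵗ G J)⁻¹ Jᵗ = G⁻¹`: the inverse metric absorbs the two
factors `J` in the arguments of `B`. This is the tensorial half of the chart independence of `H`. -/
theorem metricTrace_comp (D : RSpace n →L[ℝ] E) (J : RSpace n →L[ℝ] RSpace n)
    (hJ : J.det ≠ 0) (B : RSpace n →L[ℝ] RSpace n →L[ℝ] E) :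
    ∑ i, ∑ j, (gramMatrix (D.comp J))⁻¹ i j • B (J (stdVec i)) (J (stdVec j)) =
      metricTrace D B := by
  have hJ' : IsUnit (stdMatrix J).det := by rw [det_stdMatrix]; exact hJ.isUnit
  have hJt : IsUnit (stdMatrix J).transpose.det := by rwa [Matrix.det_transpose]
  have key : stdMatrix J * (gramMatrix (D.comp J))⁻¹ * (stdMatrix J).transpose =
      (gramMatrix D)⁻¹ := by
    rw [gramMatrix_comp, Matrix.mul_inv_rev, Matrix.mul_inv_rev, ← Matrix.mul_assoc,
      Matrix.mul_nonsing_inv _ hJ', Matrix.one_mul, Matrix.mul_assoc,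
      Matrix.nonsing_inv_mul _ hJt, Matrix.mul_one]
  rw [metricTrace, ← key]
  have hB : ∀ i j, B (J (stdVec i)) (J (stdVec j)) =
      ∑ k, ∑ l, (stdMatrix J k i * stdMatrix J l j) • B (stdVec k) (stdVec l) := by
    intro i j
    rw [map_eq_sum_stdVec B (J (stdVec i)), sum_apply]
    refine Finset.sum_congr rfl fun k _ => ?_
    rw [smul_apply, map_eq_sum_stdVec (B (stdVec k)), Finset.smul_sum]
    exact Finset.sum_congr rfl fun l _ => by rw [smul_smul]; rfl
  simp only [hB, Finset.smul_sum, smul_smul, Matrix.mul_apply, Matrix.transpose_apply,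
    Finset.sum_mul, Finset.sum_smul]
  have swap : ∀ f : Fin n → Fin n → Fin n → Fin n → E,
      ∑ i, ∑ j, ∑ k, ∑ l, f i j k l = ∑ k, ∑ l, ∑ j, ∑ i, f i j k l := by
    intro f
    rw [Finset.sum_comm]
    have : ∀ j, ∑ i, ∑ k, ∑ l, f i j k l = ∑ k, ∑ l, ∑ i, f i j k l := fun j => by
      rw [Finset.sum_comm]
      exact Finset.sum_congr rfl fun k _ => Finset.sum_comm
    simp only [this]
    rw [Finset.sum_comm]
    exact Finset.sum_congr rfl fun k _ => Finset.sum_comm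
  rw [swap]
  refine Finset.sum_congr rfl fun k _ => Finset.sum_congr rfl fun l _ =>
    Finset.sum_congr rfl fun j _ => Finset.sum_congr rfl fun i _ => ?_
  congr 1
  ring

end LinearAlgebra

/-! ### Smoothness of determinants and inverses, and Jacobi's formula. -/

section MatrixCalculus

variable {n : ℕ}

theorem contDiffAt_det {V : Type*} [NormedAddCommGroup V] [NormedSpace ℝ V]
    {m : WithTop ℕ∞} {A : V → Matrix (Fin n) (Fin n) ℝ} {y : V}
    (hA : ∀ i j, ContDiffAt ℝ m (fun z => A z i j) y) : ContDiffAt ℝ m (fun z => (A z).det) y := by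
  simp only [Matrix.det_apply]
  refine ContDiffAt.sum fun σ _ => ?_
  exact (contDiffAt_prod fun i _ => hA _ _).const_smul _

theorem contDiffAt_inv_apply {V : Type*} [NormedAddCommGroup V] [NormedSpace ℝ V]
    {m : WithTop ℕ∞} {A : V → Matrix (Fin n) (Fin n) ℝ} {y : V}
    (hA : ∀ i j, ContDiffAt ℝ m (fun z => A z i j) y) (hy : (A y).det ≠ 0) (i j : Fin n) :
    ContDiffAt ℝ m (fun z => (A z)⁻¹ i j) y := by
  simp only [Matrix.inv_def, Matrix.smul_apply, Matrix.adjugate_apply, Ring.inverse_eq_inv',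
    smul_eq_mul]
  refine ((contDiffAt_det hA).inv hy).mul (contDiffAt_det fun k l => ?_)
  by_cases hk : k = j
  · subst hk
    simpa using contDiffAt_const
  · simpa [Matrix.updateRow_ne hk] using hA k l

/-- Jacobi's formula for the derivative of a determinant. -/
theorem hasDerivAt_det {A : ℝ → Matrix (Fin n) (Fin n) ℝ} {A' : Matrix (Fin n) (Fin n) ℝ} {t : ℝ}
    (hA : ∀ i j, HasDerivAt (fun s => A s i j) (A' i j) t) (hu : IsUnit (A t).det) :
    HasDerivAt (fun s => (A s).det) ((A t).det * ((A t)⁻¹ * A').trace) t := by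
  let d : (Fin n → Fin n → ℝ) → ℝ := fun X => (Matrix.of X).det
  have hd : Differentiable ℝ d := by
    have : ContDiff ℝ 1 d := contDiff_iff_contDiffAt.2 fun X => contDiffAt_det fun i j => by
      simp only [Matrix.of_apply]
      fun_prop
    exact this.differentiable one_ne_zero
  have hc : HasDerivAt (fun s => (fun i j => A s i j : Fin n → Fin n → ℝ)) (fun i j => A' i j) t :=
    hasDerivAt_pi.2 fun i => hasDerivAt_pi.2 fun j => hA i j
  have h1 := (hd (fun i j => A t i j)).hasFDerivAt.comp_hasDerivAt t hc
  -- By the chain rule only the velocity `A'` matters, so the curve may be replaced by the straight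
  -- line `A t + s A'`. There `det (1 + s (A t)⁻¹ A')` is a polynomial in `s` with linear
  -- coefficient the trace.
  have hl : HasDerivAt (fun s : ℝ => (fun i j => A t i j + s * A' i j : Fin n → Fin n → ℝ))
      (fun i j => A' i j) 0 :=
    hasDerivAt_pi.2 fun i => hasDerivAt_pi.2 fun j => by
      simpa using ((hasDerivAt_id (0 : ℝ)).mul_const (A' i j)).const_add (A t i j)
  have h2 : HasDerivAt (fun s : ℝ => d (fun i j => A t i j + s * A' i j))
      (fderiv ℝ d (fun i j => A t i j) (fun i j => A' i j)) 0 := by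
    have h0 : (fun i j => A t i j + 0 * A' i j : Fin n → Fin n → ℝ) = fun i j => A t i j := by
      simp
    have h := (hd (fun i j => A t i j + 0 * A' i j)).hasFDerivAt.comp_hasDerivAt (0 : ℝ) hl
    rw [h0] at h
    exact h
  have h3 : HasDerivAt (fun s : ℝ => d (fun i j => A t i j + s * A' i j))
      ((A t).det * ((A t)⁻¹ * A').trace) 0 := by
    obtain ⟨p, hp⟩ : ∃ p : Polynomial ℝ, ∀ s : ℝ, (1 + s • ((A t)⁻¹ * A')).det =
        1 + ((A t)⁻¹ * A').trace * s + p.eval s * s ^ 2 :=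
      ⟨_, fun s => Matrix.det_one_add_smul s _⟩
    have heq : (fun s : ℝ => d (fun i j => A t i j + s * A' i j)) =
        fun s => (A t).det * (1 + ((A t)⁻¹ * A').trace * s + p.eval s * s ^ 2) := by
      funext s
      rw [← hp, ← Matrix.det_mul, Matrix.mul_add, Matrix.mul_smul, ← Matrix.mul_assoc,
        Matrix.mul_nonsing_inv _ hu, Matrix.one_mul, Matrix.mul_one]
      rfl
    rw [heq]
    have hlin : HasDerivAt (fun s : ℝ => 1 + ((A t)⁻¹ * A').trace * s + p.eval s * s ^ 2)
        (((A t)⁻¹ * A').trace) 0 := by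
      have := (((hasDerivAt_id (0 : ℝ)).const_mul ((A t)⁻¹ * A').trace).const_add 1).add
        ((p.hasDerivAt 0).mul (hasDerivAt_pow 2 (0 : ℝ)))
      simpa [Pi.add_def, Pi.mul_def] using this
    exact hlin.const_mul _
  rw [← h2.unique h3]
  exact h1

end MatrixCalculus

/-! ### The divergence of the tangential part of a constant vector. -/

section Divergence

variable {n : ℕ} {E : Type*} [NormedAddCommGroup E] [InnerProductSpace ℝ E]

theorem contDiffAt_gramMatrix_apply {V : Type*} [NormedAddCommGroup V] [NormedSpace ℝ V]
    {m : WithTop ℕ∞} {D : V → RSpace n →L[ℝ] E} {y : V} (hD : ContDiffAt ℝ m D y) (i j : Fin n) :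
    ContDiffAt ℝ m (fun z => gramMatrix (D z) i j) y := by
  simp only [gramMatrix_apply]
  exact (hD.clm_apply contDiffAt_const).inner ℝ (hD.clm_apply contDiffAt_const)

theorem contDiffAt_sqrt_det_gramMatrix {V : Type*} [NormedAddCommGroup V] [NormedSpace ℝ V]
    {m : WithTop ℕ∞} {D : V → RSpace n →L[ℝ] E} {y : V} (hD : ContDiffAt ℝ m D y)
    (hy : Function.Injective (D y)) : ContDiffAt ℝ m (fun z => √(gramMatrix (D z)).det) y :=
  (contDiffAt_det (contDiffAt_gramMatrix_apply hD)).sqrt (gramMatrix_det_pos hy).ne'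

theorem contDiffAt_tangentCoeff {V : Type*} [NormedAddCommGroup V] [NormedSpace ℝ V]
    {m : WithTop ℕ∞} {D : V → RSpace n →L[ℝ] E} {y : V} (hD : ContDiffAt ℝ m D y)
    (hy : Function.Injective (D y)) (T : E) : ContDiffAt ℝ m (fun z => tangentCoeff (D z) T) y := by
  rw [contDiffAt_euclidean]
  intro k
  simp only [tangentCoeff_apply]
  refine ContDiffAt.sum fun i _ => ?_
  exact (contDiffAt_inv_apply (contDiffAt_gramMatrix_apply hD) (gramMatrix_det_pos hy).ne' k i).mul
    ((hD.clm_apply contDiffAt_const).inner ℝ contDiffAt_const)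

/-- The divergence of a vector field on `ℝⁿ`. -/
def divergence (W : RSpace n → RSpace n) (y : RSpace n) : ℝ :=
  ∑ k, fderiv ℝ W y (stdVec k) k

/-- The tangential part of the constant vector `T`, multiplied by the density of the volume. -/
def densityField (D : RSpace n → RSpace n →L[ℝ] E) (T : E) (y : RSpace n) : RSpace n :=
  √(gramMatrix (D y)).det • tangentCoeff (D y) T

theorem contDiffAt_densityField {m : WithTop ℕ∞} {D : RSpace n → RSpace n →L[ℝ] E} {y : RSpace n}
    (hD : ContDiffAt ℝ m D y) (hy : Function.Injective (D y)) (T : E) :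
    ContDiffAt ℝ m (densityField D T) y :=
  (contDiffAt_sqrt_det_gramMatrix hD hy).smul (contDiffAt_tangentCoeff hD hy T)

theorem hasDerivAt_coord {c : ℝ → RSpace n} {c' : RSpace n} {t : ℝ} (hc : HasDerivAt c c' t)
    (k : Fin n) : HasDerivAt (fun s => c s k) (c' k) t :=
  (EuclideanSpace.proj k : RSpace n →L[ℝ] ℝ).hasFDerivAt.comp_hasDerivAt t hc

theorem hasDerivAt_gramMatrix_apply {D : ℝ → RSpace n →L[ℝ] E} {D' : RSpace n →L[ℝ] E} {t : ℝ}
    (hD : HasDerivAt D D' t) (i j : Fin n) :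
    HasDerivAt (fun s => gramMatrix (D s) i j)
      (inner ℝ (D t (stdVec i)) (D' (stdVec j)) + inner ℝ (D' (stdVec i)) (D t (stdVec j))) t := by
  have h : ∀ i, HasDerivAt (fun s => D s (stdVec i)) (D' (stdVec i)) t := fun i => by
    simpa using hD.clm_apply (hasDerivAt_const t (stdVec i))
  exact (h i).inner ℝ (h j)

/-- In Jacobi's formula the two halves of the derivative of the Gram matrix have the same trace
against the symmetric `G⁻¹`. The resulting factor 2 cancels the one from the square root. -/
theorem hasDerivAt_sqrt_det_gramMatrix {D : ℝ → RSpace n →L[ℝ] E} {D' : RSpace n →L[ℝ] E} {t : ℝ}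
    (hD : HasDerivAt D D' t) (hi : Function.Injective (D t)) :
    HasDerivAt (fun s => √(gramMatrix (D s)).det)
      (√(gramMatrix (D t)).det *
        ∑ i, ∑ j, (gramMatrix (D t))⁻¹ i j * inner ℝ (D t (stdVec i)) (D' (stdVec j))) t := by
  have hpos := gramMatrix_det_pos hi
  have h := (hasDerivAt_det (A' := Matrix.of fun i j => inner ℝ (D t (stdVec i)) (D' (stdVec j)) +
    inner ℝ (D' (stdVec i)) (D t (stdVec j))) (hasDerivAt_gramMatrix_apply hD)
    (isUnit_gramMatrix_det hi)).sqrt hpos.ne'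
  convert h using 1
  have hs : ∀ i j, (gramMatrix (D t))⁻¹ j i = (gramMatrix (D t))⁻¹ i j := fun i j => by
    conv_rhs => rw [← gramMatrix_symm (D t), ← Matrix.transpose_nonsing_inv]
    rfl
  have htr : ((gramMatrix (D t))⁻¹ * Matrix.of fun i j => inner ℝ (D t (stdVec i)) (D' (stdVec j)) +
      inner ℝ (D' (stdVec i)) (D t (stdVec j))).trace =
      2 * ∑ i, ∑ j, (gramMatrix (D t))⁻¹ i j * inner ℝ (D t (stdVec i)) (D' (stdVec j)) := by
    simp only [Matrix.trace, Matrix.diag, Matrix.mul_apply, Matrix.of_apply, mul_add,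
      Finset.sum_add_distrib, two_mul]
    congr 1
    · rw [Finset.sum_comm]
      exact Finset.sum_congr rfl fun i _ => Finset.sum_congr rfl fun j _ => by rw [hs]
    · exact Finset.sum_congr rfl fun i _ => Finset.sum_congr rfl fun j _ => by
        rw [real_inner_comm]
  rw [htr]
  have hq := Real.mul_self_sqrt hpos.le
  have hq0 := (Real.sqrt_pos.2 hpos).ne'
  rw [eq_div_iff (by positivity)]
  nth_rewrite 3 [← hq]
  ring

/-- No inverse matrix is differentiated. The relation `⟨D eᵢ, D a⟩ = ⟨D eᵢ, T⟩` characterizing the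
coefficients `a` is differentiated instead, and the result is solved for `a'` by applying `G⁻¹`.
Injectivity near `t` is needed for the relation to hold along the curve. -/
theorem hasDerivAt_tangentCoeff_apply {D : ℝ → RSpace n →L[ℝ] E} {D' : RSpace n →L[ℝ] E} {t : ℝ}
    (hD : HasDerivAt D D' t) (hi : Function.Injective (D t)) (T : E)
    (hd : DifferentiableAt ℝ (fun s => tangentCoeff (D s) T) t)
    (hinj : ∀ᶠ s in nhds t, Function.Injective (D s)) (k : Fin n) :
    HasDerivAt (fun s => tangentCoeff (D s) T k)
      (∑ i, (gramMatrix (D t))⁻¹ k i *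
        (inner ℝ (D' (stdVec i)) (T - D t (tangentCoeff (D t) T)) -
          inner ℝ (D t (stdVec i)) (D' (tangentCoeff (D t) T)))) t := by
  set a := fun s => tangentCoeff (D s) T with ha
  set a' := deriv a t with ha'
  have hda : HasDerivAt a a' t := hd.hasDerivAt
  have hDi : ∀ i, HasDerivAt (fun s => D s (stdVec i)) (D' (stdVec i)) t := fun i => by
    simpa using hD.clm_apply (hasDerivAt_const t (stdVec i))
  have hDa : HasDerivAt (fun s => D s (a s)) (D' (a t) + D t a') t := hD.clm_apply hda
  have heq : ∀ i, inner ℝ (D t (stdVec i)) (D t a') =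
      inner ℝ (D' (stdVec i)) (T - D t (a t)) - inner ℝ (D t (stdVec i)) (D' (a t)) := fun i => by
    have h1 := (hDi i).inner ℝ hDa
    have h2 := (hDi i).inner ℝ (hasDerivAt_const t T)
    have h3 : (fun s => inner ℝ (D s (stdVec i)) (D s (a s))) =ᶠ[nhds t]
        fun s => inner ℝ (D s (stdVec i)) T :=
      hinj.mono fun s hs => inner_map_tangentCoeff hs T _
    have h4 := h1.unique (h2.congr_of_eventuallyEq h3)
    rw [inner_add_right, inner_zero_right] at h4
    rw [inner_sub_right]
    linarith
  have hk : HasDerivAt (fun s => a s k) (a' k) t := hasDerivAt_coord hda k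
  convert hk using 1
  have hmul : ∀ i, inner ℝ (D t (stdVec i)) (D t a') = (gramMatrix (D t)).mulVec a'.ofLp i := by
    intro i
    rw [← dotProduct_gramMatrix_mulVec]
    simp
  have : (gramMatrix (D t))⁻¹.mulVec ((gramMatrix (D t)).mulVec a'.ofLp) = a'.ofLp := by
    rw [Matrix.mulVec_mulVec, Matrix.nonsing_inv_mul _ (isUnit_gramMatrix_det hi),
      Matrix.one_mulVec]
  rw [← this]
  exact Finset.sum_congr rfl fun i _ => congrArg _ ((heq i).symm.trans (hmul i))

/-- The derivative of the density contributes `G^{ij} ⟨D eᵢ, B(a, eⱼ)⟩`. The derivative of the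
coefficients contributes the same expression with the opposite sign, by the symmetry of `B` and `G`.
What survives is the trace of `B` paired with the normal part of `T`. -/
theorem divergence_densityField {D : RSpace n → RSpace n →L[ℝ] E}
    {B : RSpace n →L[ℝ] RSpace n →L[ℝ] E} {y : RSpace n} (hD : ContDiffAt ℝ 1 D y)
    (hB : HasFDerivAt D B y) (hsymm : ∀ v w, B v w = B w v)
    (hinj : ∀ᶠ z in nhds y, Function.Injective (D z)) (T : E) :
    divergence (densityField D T) y =
      √(gramMatrix (D y)).det *
        inner ℝ (metricTrace (D y) B) (T - D y (tangentCoeff (D y) T)) := by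
  have hi : Function.Injective (D y) := hinj.self_of_nhds
  have hline : ∀ k : Fin n, HasDerivAt (fun s : ℝ => y + s • (stdVec k : RSpace n)) (stdVec k) 0 :=
    fun k => by simpa using ((hasDerivAt_id (0 : ℝ)).smul_const (stdVec k : RSpace n)).const_add y
  have h0 : ∀ k : Fin n, y + (0 : ℝ) • (stdVec k : RSpace n) = y := fun k => by simp
  set s := √(gramMatrix (D y)).det with hs
  set a := tangentCoeff (D y) T with ha
  set P := T - D y a with hP
  have hterm : ∀ k, fderiv ℝ (densityField D T) y (stdVec k) k =
      s * (∑ i, (gramMatrix (D y))⁻¹ k i *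
        (inner ℝ (B (stdVec k) (stdVec i)) P - inner ℝ (D y (stdVec i)) (B (stdVec k) a))) +
      s * (∑ i, ∑ j, (gramMatrix (D y))⁻¹ i j *
        inner ℝ (D y (stdVec i)) (B (stdVec k) (stdVec j))) * a k := by
    intro k
    have hDk : HasDerivAt (fun s : ℝ => D (y + s • (stdVec k : RSpace n))) (B (stdVec k)) 0 := by
      have h : HasFDerivAt D B (y + (0 : ℝ) • (stdVec k : RSpace n)) := by rwa [h0]
      exact h.comp_hasDerivAt (0 : ℝ) (hline k)
    have hcont : Filter.Tendsto (fun s : ℝ => y + s • (stdVec k : RSpace n)) (nhds 0) (nhds y) := by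
      have := (hline k).continuousAt.tendsto
      rwa [h0] at this
    have hda : DifferentiableAt ℝ
        (fun s : ℝ => tangentCoeff (D (y + s • (stdVec k : RSpace n))) T) 0 := by
      have h := (contDiffAt_tangentCoeff hD hi T).differentiableAt one_ne_zero
      rw [← h0 k] at h
      exact DifferentiableAt.comp (0 : ℝ) (g := fun z => tangentCoeff (D z) T) h
        (hline k).differentiableAt
    have h1 := hasDerivAt_tangentCoeff_apply hDk (by simpa using hi) T hda
      (hcont.eventually hinj) k
    have h2 := hasDerivAt_sqrt_det_gramMatrix hDk (by simpa using hi)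
    have h3 := h2.mul h1
    have h4 : HasDerivAt (fun s : ℝ => densityField D T (y + s • (stdVec k : RSpace n)))
        (fderiv ℝ (densityField D T) y (stdVec k)) 0 := by
      have h := ((contDiffAt_densityField hD hi T).differentiableAt one_ne_zero).hasFDerivAt
      have h' : HasFDerivAt (densityField D T) (fderiv ℝ (densityField D T) y)
        (y + (0 : ℝ) • (stdVec k : RSpace n)) := by rwa [h0]
      exact h'.comp_hasDerivAt (0 : ℝ) (hline k)
    have h5 := hasDerivAt_coord h4 k
    have h6 := h5.unique h3
    rw [h6]
    simp only [h0]
    ring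
  have hgs : ∀ i j, (gramMatrix (D y))⁻¹ j i = (gramMatrix (D y))⁻¹ i j := fun i j => by
    conv_rhs => rw [← gramMatrix_symm (D y), ← Matrix.transpose_nonsing_inv]
    rfl
  have e1 : ∑ k, (∑ i, ∑ j, (gramMatrix (D y))⁻¹ i j *
        inner ℝ (D y (stdVec i)) (B (stdVec k) (stdVec j))) * a k =
      ∑ k, ∑ i, (gramMatrix (D y))⁻¹ k i * inner ℝ (D y (stdVec i)) (B (stdVec k) a) := by
    simp only [Finset.sum_mul]
    rw [Finset.sum_comm, Finset.sum_comm (s := Finset.univ) (t := Finset.univ)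
      (f := fun k i => (gramMatrix (D y))⁻¹ k i * inner ℝ (D y (stdVec i)) (B (stdVec k) a))]
    refine Finset.sum_congr rfl fun i _ => ?_
    rw [Finset.sum_comm]
    refine Finset.sum_congr rfl fun j _ => ?_
    rw [hgs i j, map_eq_sum_stdVec (B (stdVec j)) a, inner_sum, Finset.mul_sum]
    refine Finset.sum_congr rfl fun k _ => ?_
    rw [hsymm (stdVec k), real_inner_smul_right]
    ring
  rw [divergence, Finset.sum_congr rfl fun k _ => hterm k, Finset.sum_add_distrib]
  have e2 : ∑ k, s * (∑ i, ∑ j, (gramMatrix (D y))⁻¹ i j *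
        inner ℝ (D y (stdVec i)) (B (stdVec k) (stdVec j))) * a k =
      s * ∑ k, ∑ i, (gramMatrix (D y))⁻¹ k i * inner ℝ (D y (stdVec i)) (B (stdVec k) a) := by
    rw [← e1, Finset.mul_sum]
    exact Finset.sum_congr rfl fun k _ => by ring
  rw [e2, ← Finset.mul_sum, ← mul_add]
  congr 1
  simp only [mul_sub, Finset.sum_sub_distrib, sub_add_cancel, metricTrace, sum_inner,
    real_inner_smul_left]

end Divergence

/-! ### Integration by parts for Lipschitz functions on `ℝⁿ`. -/

section IntegrationByParts

open Filter Topology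
open scoped NNReal

variable {n : ℕ}

theorem fderiv_coord {W : RSpace n → RSpace n} {y : RSpace n} (hW : DifferentiableAt ℝ W y)
    (v : RSpace n) (k : Fin n) : fderiv ℝ (fun z => W z k) y v = fderiv ℝ W y v k := by
  have h := (EuclideanSpace.proj k : RSpace n →L[ℝ] ℝ).hasFDerivAt.comp y hW.hasFDerivAt
  have h' : HasFDerivAt (fun z => W z k)
    ((EuclideanSpace.proj k : RSpace n →L[ℝ] ℝ).comp (fderiv ℝ W y)) y := h
  rw [h'.fderiv]
  rfl

theorem integrable_lineDeriv_mul {φ g : RSpace n → ℝ} {C : ℝ≥0} (hφ : LipschitzWith C φ)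
    (hg : Continuous g) (hgc : HasCompactSupport g) (v : RSpace n) :
    Integrable (fun y => lineDeriv ℝ φ y v * g y) :=
  (hφ.locallyIntegrable_lineDeriv v).integrable_smul_right_of_hasCompactSupport hg hgc

/-- Rademacher's theorem: almost everywhere the derivative exists and is assembled from the
directional derivatives, for which integrability and integration by parts can be treated one
coordinate at a time. -/
theorem fderiv_apply_ae_eq_sum_lineDeriv {φ : RSpace n → ℝ} {C : ℝ≥0} (hφ : LipschitzWith C φ)
    (W : RSpace n → RSpace n) :
    (fun y => fderiv ℝ φ y (W y)) =ᵐ[volume] fun y => ∑ k, lineDeriv ℝ φ y (stdVec k) * W y k := by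
  filter_upwards [hφ.ae_differentiableAt] with y hy
  rw [map_eq_sum_stdVec]
  exact Finset.sum_congr rfl fun k _ => by rw [hy.lineDeriv_eq_fderiv, smul_eq_mul, mul_comm]

theorem integrable_fderiv_apply {φ : RSpace n → ℝ} {C : ℝ≥0} (hφ : LipschitzWith C φ)
    {W : RSpace n → RSpace n} (hW : Continuous W) (hWc : HasCompactSupport W) :
    Integrable (fun y => fderiv ℝ φ y (W y)) := by
  refine Integrable.congr ?_ (fderiv_apply_ae_eq_sum_lineDeriv hφ W).symm
  refine integrable_finsetSum _ fun k _ => integrable_lineDeriv_mul hφ (by fun_prop) ?_ _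
  exact hWc.comp_left (g := fun w : RSpace n => w k) rfl

/-- Integration by parts of a Lipschitz function against the divergence of a compactly supported
vector field. -/
theorem integral_mul_divergence {φ : RSpace n → ℝ} {C : ℝ≥0} (hφ : LipschitzWith C φ)
    {W : RSpace n → RSpace n} (hW : ContDiff ℝ 1 W) (hWc : HasCompactSupport W) :
    ∫ y, φ y * divergence W y = -∫ y, fderiv ℝ φ y (W y) := by
  have hWd : Differentiable ℝ W := hW.differentiable one_ne_zero
  have hk : ∀ k, ContDiff ℝ 1 (fun y => W y k) := fun k => contDiff_euclidean.1 hW k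
  have hkc : ∀ k, HasCompactSupport (fun y => W y k) := fun k =>
    hWc.comp_left (g := fun w : RSpace n => w k) rfl
  have hd : ∀ k, ∀ y, lineDeriv ℝ (fun y => W y k) y (-stdVec k) =
      -(fderiv ℝ W y (stdVec k) k) := fun k y => by
    rw [((hk k).differentiable one_ne_zero y).lineDeriv_eq_fderiv, map_neg, fderiv_coord (hWd y)]
  have hcont : ∀ k, Continuous fun y => fderiv ℝ W y (stdVec k) k := fun k => by
    have := hW.continuous_fderiv one_ne_zero
    fun_prop
  have hsupp : ∀ k, HasCompactSupport fun y => fderiv ℝ W y (stdVec k) k := fun k =>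
    (hWc.fderiv ℝ).comp_left (g := fun D : RSpace n →L[ℝ] RSpace n => D (stdVec k) k) rfl
  rw [integral_congr_ae (fderiv_apply_ae_eq_sum_lineDeriv hφ W),
    integral_finsetSum _ fun k _ => integrable_lineDeriv_mul hφ (hk k).continuous (hkc k) _]
  simp only [divergence, Finset.mul_sum]
  rw [integral_finsetSum _ fun k _ => ?_, ← Finset.sum_neg_distrib]
  · refine Finset.sum_congr rfl fun k _ => ?_
    -- The formula used requires both factors to be Lipschitz; the field component is, being `C¹`
    -- with compact support.
    obtain ⟨D, hD⟩ := (hk k).lipschitzWith_of_hasCompactSupport (hkc k) one_ne_zero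
    rw [hφ.integral_lineDeriv_mul_eq hD (hkc k), ← integral_neg]
    refine integral_congr_ae (ae_of_all _ fun y => ?_)
    simp only [hd]
    ring
  · exact (hφ.continuous.mul (hcont k)).integrable_of_hasCompactSupport (hsupp k).mul_left

theorem divergence_smul {ρ : RSpace n → ℝ} {W : RSpace n → RSpace n} {y : RSpace n}
    (hρ : DifferentiableAt ℝ ρ y) (hW : DifferentiableAt ℝ W y) :
    divergence (fun z => ρ z • W z) y = ρ y * divergence W y + fderiv ℝ ρ y (W y) := by
  have h : HasFDerivAt (fun z => ρ z • W z) _ y := hρ.hasFDerivAt.smul hW.hasFDerivAt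
  rw [divergence, h.fderiv, map_eq_sum_stdVec (fderiv ℝ ρ y), divergence, Finset.mul_sum,
    ← Finset.sum_add_distrib]
  refine Finset.sum_congr rfl fun k _ => ?_
  simp [mul_comm]

theorem divergence_congr {W W' : RSpace n → RSpace n} {y : RSpace n} (h : W =ᶠ[𝓝 y] W') :
    divergence W y = divergence W' y := by
  simp only [divergence, h.fderiv_eq]

end IntegrationByParts

/-! ### Length spaces and the Hopf–Rinow theorem. -/

section HopfRinow

open Filter Topology Metric Manifold
open scoped ENNReal

/-- Hopf–Rinow: closed balls of a complete locally compact length space are compact. -/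
theorem isCompact_closedEBall_of_length {α : Type*} [EMetricSpace α] [CompleteSpace α]
    [LocallyCompactSpace α]
    (hlen : ∀ (p q : α) (a b : ℝ), 0 < a → 0 < b →
      edist p q < ENNReal.ofReal a + ENNReal.ofReal b →
      ∃ z : α, edist p z < ENNReal.ofReal a ∧ edist z q < ENNReal.ofReal b)
    (p : α) (r : ℝ) : IsCompact (closedEBall p (ENNReal.ofReal r)) := by
  by_contra hr
  -- The radii of compact balls are closed downwards. If they were bounded, their supremum `R` would
  -- itself be such a radius, and local compactness would then push past it.
  set S : Set ℝ := {s | IsCompact (closedEBall p (ENNReal.ofReal s))} with hS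
  have hdown : ∀ s ∈ S, ∀ t ≤ s, t ∈ S := fun s hs t hts =>
    IsCompact.of_isClosed_subset hs isClosed_closedEBall
      (closedEBall_subset_closedEBall (ENNReal.ofReal_le_ofReal hts))
  have h0 : (0 : ℝ) ∈ S := by simp [hS]
  have hbdd : BddAbove S := ⟨r, fun s hs => by
    by_contra! h
    exact hr (hdown s hs r h.le)⟩
  set R := sSup S with hR
  have hR0 : 0 ≤ R := le_csSup hbdd h0
  have hlt : ∀ t < R, t ∈ S := fun t ht => by
    obtain ⟨s, hs, hts⟩ := exists_lt_of_lt_csSup ⟨0, h0⟩ ht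
    exact hdown s hs t hts.le
  have hRS : R ∈ S := by
    rcases hR0.eq_or_lt with h | h
    · rwa [← h]
    refine (isCompact_iff_totallyBounded_isComplete.2 ⟨?_, isClosed_closedEBall.isComplete⟩)
    rw [EMetric.totallyBounded_iff]
    intro ε hε
    obtain ⟨e, he0, heε⟩ := ENNReal.lt_iff_exists_nnreal_btwn.1 hε
    have he : 0 < (e : ℝ) := by exact_mod_cast he0
    -- With `a ≥ R - e/4`, every point of the `R`-ball is within `e/2` of the compact `a`-ball, so a
    -- finite `e/2`-net of the latter is an `e`-net of the former. The term `R/2` only keeps `a`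
    -- positive, as `hlen` demands.
    set a := max (R - e / 4) (R / 2) with ha
    have ha0 : 0 < a := lt_max_of_lt_right (by linarith)
    have haR : a < R := max_lt (by linarith) (by linarith)
    obtain ⟨t, ht, hcov⟩ := EMetric.totallyBounded_iff.1 (hlt a haR).totallyBounded
      (ENNReal.ofReal (e / 2)) (by simpa using he)
    refine ⟨t, ht, fun q hq => ?_⟩
    obtain ⟨z, hz, hzq⟩ := hlen p q a (e / 2) ha0 (by linarith) (by
      rw [← ENNReal.ofReal_add ha0.le (by linarith)]
      rw [mem_closedEBall, edist_comm] at hq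
      refine hq.trans_lt ((ENNReal.ofReal_lt_ofReal_iff (by linarith)).2 ?_)
      have := le_max_left (R - e / 4) (R / 2)
      linarith)
    have hz' := hcov (show z ∈ closedEBall p (ENNReal.ofReal a) by
      rw [mem_closedEBall, edist_comm]; exact hz.le)
    simp only [Set.mem_iUnion, mem_eball, exists_prop] at hz' ⊢
    obtain ⟨y, hy, hzy⟩ := hz'
    refine ⟨y, hy, lt_of_le_of_lt (edist_triangle q z y) (lt_of_lt_of_le ?_ heε.le)⟩
    rw [edist_comm] at hzq
    calc edist q z + edist z y < ENNReal.ofReal (e / 2) + ENNReal.ofReal (e / 2) :=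
          ENNReal.add_lt_add hzq hzy
      _ = e := by
          rw [← ENNReal.ofReal_add (by linarith) (by linarith), add_halves, ENNReal.ofReal_coe_nnreal]
  -- In a length space the ball of radius `R + δ/2` lies in the closed `δ`-thickening of the
  -- `R`-ball. The halved increment gives the strict inequality needed in `hlen`.
  obtain ⟨δ, hδ, hK⟩ := IsCompact.exists_isCompact_cthickening (show IsCompact _ from hRS)
  have hmem : R + δ / 2 ∈ S := by
    refine IsCompact.of_isClosed_subset hK isClosed_closedEBall fun q hq => ?_
    rw [mem_closedEBall, edist_comm] at hq
    rw [mem_cthickening_iff]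
    rcases hR0.eq_or_lt with h | h
    · rw [← h, zero_add] at hq
      refine (infEDist_le_edist_of_mem (y := p) (mem_closedEBall_self)).trans ?_
      rw [edist_comm]
      exact hq.trans (ENNReal.ofReal_le_ofReal (by linarith))
    · obtain ⟨z, hz, hzq⟩ := hlen p q R δ h hδ (by
        rw [← ENNReal.ofReal_add hR0 hδ.le]
        exact hq.trans_lt ((ENNReal.ofReal_lt_ofReal_iff (by linarith)).2 (by linarith)))
      refine (infEDist_le_edist_of_mem (y := z) ?_).trans ?_
      · rw [mem_closedEBall, edist_comm]
        exact hz.le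
      · rw [edist_comm]
        exact hzq.le
  have := le_csSup hbdd hmem
  linarith

/-- Riemannian manifolds are length spaces: they have approximate intermediate points. -/
theorem exists_edist_lt_edist_lt (n : ℕ) {M : Type*} [EMetricSpace M]
    [ChartedSpace (RSpace n) M]
    [RiemannianBundle (fun x : M => TangentSpace (𝓡 n) x)]
    [IsRiemannianManifold (𝓡 n) M]
    {p q : M} {a b : ℝ≥0∞} (hb0 : 0 < b) (hb : b ≠ ⊤)
    (ha0 : 0 < a) (h : edist p q < a + b) : ∃ z : M, edist p z < a ∧ edist z q < b := by
  rw [IsRiemannianManifold.out (I := 𝓡 n)] at h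
  obtain ⟨γ, h0, h1, hγ, hL⟩ := exists_lt_of_riemannianEDist_lt h
  by_contra! hcon
  have hcont : ContinuousOn (fun t => edist p (γ t)) (Set.Icc 0 1) :=
    fun t ht => Filter.Tendsto.edist tendsto_const_nhds (hγ.continuousOn t ht)
  have hle : ∀ t ∈ Set.Icc (0 : ℝ) 1, edist p (γ t) ≤ pathELength (𝓡 n) γ 0 t ∧
      edist (γ t) q ≤ pathELength (𝓡 n) γ t 1 := fun t ht => by
    rw [IsRiemannianManifold.out (I := 𝓡 n), IsRiemannianManifold.out (I := 𝓡 n)]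
    exact ⟨riemannianEDist_le_pathELength
        (hγ.mono (Set.Icc_subset_Icc le_rfl ht.2)) h0 rfl ht.1,
      riemannianEDist_le_pathELength
        (hγ.mono (Set.Icc_subset_Icc ht.1 le_rfl)) rfl h1 ht.2⟩
  by_cases hq : edist p q < a
  · exact (hcon q hq).not_gt (by simpa using hb0)
  push Not at hq
  set L := pathELength (𝓡 n) γ 0 1 with hLdef
  have hLa : L - b < a := by
    by_contra! hle'
    have hbL : b < L := tsub_pos_iff_lt.1 (ha0.trans_le hle')
    exact hL.not_ge (by
      calc a + b ≤ L - b + b := by gcongr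
        _ = L := tsub_add_cancel_of_le hbL.le)
  -- By the intermediate value theorem the path meets the sphere of radius `a'` about `p`. That
  -- point is closer than `a` to `p`, so by `hcon` it is at distance at least `b` from `q`, which
  -- forces length at least `a' + b > L`.
  obtain ⟨a', ha'L, ha'a⟩ := exists_between hLa
  have hsum : L < a' + b := by
    by_contra! hle'
    exact ha'L.not_ge (ENNReal.le_sub_of_add_le_right hb hle')
  have himg := intermediate_value_Icc zero_le_one hcont
  obtain ⟨t, ht, hta⟩ := himg (show a' ∈ Set.Icc _ _ by
    simp only [h0, h1, edist_self]
    exact ⟨bot_le, ha'a.le.trans hq⟩)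
  simp only at hta
  have hb' := hcon (γ t) (hta ▸ ha'a)
  have hadd := pathELength_add (I := 𝓡 n) (γ := γ) ht.1 ht.2
  have : a' + b ≤ L := by
    rw [hLdef, ← hadd]
    exact add_le_add (hta ▸ (hle t ht).1) (hb'.trans (hle t ht).2)
  exact absurd hsum this.not_gt

/-- Hopf–Rinow: closed balls of a complete Riemannian manifold are compact. -/
theorem isCompact_closedEBall (n : ℕ) {M : Type*} [EMetricSpace M]
    [ChartedSpace (RSpace n) M]
    [RiemannianBundle (fun x : M => TangentSpace (𝓡 n) x)]
    [IsRiemannianManifold (𝓡 n) M]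
    [CompleteSpace M] (p : M) (r : ℝ) :
    IsCompact (closedEBall p (ENNReal.ofReal r)) := by
  have : LocallyCompactSpace M := Manifold.locallyCompact_of_finiteDimensional (𝓡 n)
  exact isCompact_closedEBall_of_length (fun p q a b ha hb h =>
    exists_edist_lt_edist_lt n (ENNReal.ofReal_pos.2 hb)
      ENNReal.ofReal_ne_top (ENNReal.ofReal_pos.2 ha) h) p r

end HopfRinow

/-! ### The immersion in charts, and comparison of intrinsic and extrinsic distances. -/

section Charts

open Filter Topology Manifold
open scoped NNReal ENNReal

variable {n : ℕ} {M : Type*} [EMetricSpace M] [ChartedSpace (RSpace n) M] [IsManifold (𝓡 n) ∞ M]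

theorem isOpen_target (x : M) : IsOpen (extChartAt (𝓡 n) x).target := isOpen_extChartAt_target x

theorem mdifferentiableAt_symm (x : M) {y : RSpace n} (hy : y ∈ (extChartAt (𝓡 n) x).target) :
    MDifferentiableAt 𝓘(ℝ, RSpace n) (𝓡 n) (extChartAt (𝓡 n) x).symm y :=
  ((contMDiffOn_extChartAt_symm (n := 1) x).contMDiffAt
    ((isOpen_target x).mem_nhds hy)).mdifferentiableAt one_ne_zero

/-- The differential of the inverse of a chart. -/
def chartFrame (x : M) (y : RSpace n) :
    RSpace n →L[ℝ] TangentSpace (𝓡 n) ((extChartAt (𝓡 n) x).symm y) :=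
  mfderiv 𝓘(ℝ, RSpace n) (𝓡 n) (extChartAt (𝓡 n) x).symm y

theorem chartFrame_isInvertible (x : M) {y : RSpace n} (hy : y ∈ (extChartAt (𝓡 n) x).target) :
    (chartFrame x y).IsInvertible := by
  have h := isInvertible_mfderivWithin_extChartAt_symm (I := 𝓡 n) hy
  rw [modelWithCornersSelf_coe, Set.range_id, mfderivWithin_univ] at h
  exact h

theorem chartFrame_bijective (x : M) {y : RSpace n} (hy : y ∈ (extChartAt (𝓡 n) x).target) :
    Function.Bijective (chartFrame x y) :=
  (chartFrame_isInvertible x hy).bijective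

variable {F : M → CSpace n}

theorem contDiffOn_inChart {V : Type*} [NormedAddCommGroup V] [NormedSpace ℝ V] {f : M → V}
    (hf : ContMDiff (𝓡 n) 𝓘(ℝ, V) ∞ f) (x : M) :
    ContDiffOn ℝ ∞ (f ∘ (extChartAt (𝓡 n) x).symm) (extChartAt (𝓡 n) x).target := by
  rw [← contMDiffOn_iff_contDiffOn]
  exact hf.comp_contMDiffOn (contMDiffOn_extChartAt_symm x)

theorem contDiffAt_inChart {V : Type*} [NormedAddCommGroup V] [NormedSpace ℝ V] {f : M → V}
    (hf : ContMDiff (𝓡 n) 𝓘(ℝ, V) ∞ f) (x : M) {y : RSpace n}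
    (hy : y ∈ (extChartAt (𝓡 n) x).target) :
    ContDiffAt ℝ ∞ (f ∘ (extChartAt (𝓡 n) x).symm) y :=
  (contDiffOn_inChart hf x).contDiffAt ((isOpen_target x).mem_nhds hy)

theorem fderiv_comp_symm_apply {V : Type*} [NormedAddCommGroup V] [NormedSpace ℝ V] {f : M → V}
    (hf : ContMDiff (𝓡 n) 𝓘(ℝ, V) ∞ f) (x : M) {y : RSpace n}
    (hy : y ∈ (extChartAt (𝓡 n) x).target) (w : RSpace n) :
    fderiv ℝ (f ∘ (extChartAt (𝓡 n) x).symm) y w =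
      mfderiv (𝓡 n) 𝓘(ℝ, V) f ((extChartAt (𝓡 n) x).symm y) (chartFrame x y w) := by
  have h := mfderiv_comp y ((hf _).mdifferentiableAt (by simp)) (mdifferentiableAt_symm x hy)
  rw [← mfderiv_eq_fderiv, h]
  rfl

variable [RiemannianBundle (fun x : M => TangentSpace (𝓡 n) x)]

theorem IsIsometricImmersion.norm_differential (hF : IsIsometricImmersion F) (x : M)
    (v : TangentSpace (𝓡 n) x) : ‖differential F x v‖ = ‖v‖ := by
  have h := hF.isometric x v v
  rw [real_inner_self_eq_norm_sq, real_inner_self_eq_norm_sq] at h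
  exact (pow_left_inj₀ (norm_nonneg _) (norm_nonneg _) two_ne_zero).1 h

theorem IsIsometricImmersion.enorm_differential (hF : IsIsometricImmersion F) (x : M)
    (v : TangentSpace (𝓡 n) x) : ‖differential F x v‖ₑ = ‖v‖ₑ := by
  rw [← ofReal_norm, ← ofReal_norm, hF.norm_differential]

theorem IsIsometricImmersion.differential_injective (hF : IsIsometricImmersion F) (x : M) :
    Function.Injective (differential F x) :=
  (injective_iff_map_eq_zero _).2 fun v hv => by
    rw [← norm_eq_zero, ← hF.norm_differential, hv, norm_zero]

theorem IsIsometricImmersion.fderiv_inChart_apply (hF : IsIsometricImmersion F) (x : M)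
    {y : RSpace n} (hy : y ∈ (extChartAt (𝓡 n) x).target) (w : RSpace n) :
    fderiv ℝ (inChart F x) y w =
      differential F ((extChartAt (𝓡 n) x).symm y) (chartFrame x y w) :=
  fderiv_comp_symm_apply hF.smooth x hy w

theorem IsIsometricImmersion.fderiv_inChart_injective (hF : IsIsometricImmersion F) (x : M)
    {y : RSpace n} (hy : y ∈ (extChartAt (𝓡 n) x).target) :
    Function.Injective (fderiv ℝ (inChart F x) y) := by
  intro v w h
  rw [hF.fderiv_inChart_apply x hy, hF.fderiv_inChart_apply x hy] at h
  exact (chartFrame_bijective x hy).1 (hF.differential_injective _ h)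

theorem IsIsometricImmersion.range_fderiv_inChart (hF : IsIsometricImmersion F) (x : M)
    {y : RSpace n} (hy : y ∈ (extChartAt (𝓡 n) x).target) :
    LinearMap.range (fderiv ℝ (inChart F x) y).toLinearMap =
      tangentPlane F ((extChartAt (𝓡 n) x).symm y) := by
  ext v
  simp only [tangentPlane, LinearMap.mem_range, ContinuousLinearMap.coe_coe,
    hF.fderiv_inChart_apply x hy]
  exact ((chartFrame_bijective x hy).2.exists
    (p := fun u => differential F ((extChartAt (𝓡 n) x).symm y) u = v)).symm

theorem gram_eq_gramMatrix (x : M) (y : RSpace n) :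
    gram F x y = gramMatrix (fderiv ℝ (inChart F x) y) := rfl

theorem IsIsometricImmersion.normalPart_eq (hF : IsIsometricImmersion F) (x : M)
    {y : RSpace n} (hy : y ∈ (extChartAt (𝓡 n) x).target) (T : CSpace n) :
    normalPart F ((extChartAt (𝓡 n) x).symm y) T =
      T - fderiv ℝ (inChart F x) y (tangentCoeff (fderiv ℝ (inChart F x) y) T) := by
  rw [← starProjection_orthogonal_range (hF.fderiv_inChart_injective x hy)]
  exact (congrArg (fun K : Submodule ℝ (CSpace n) => Kᗮ.starProjection T)
    (hF.range_fderiv_inChart x hy)).symm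

theorem IsIsometricImmersion.contDiffAt_fderiv_inChart (hF : IsIsometricImmersion F) (x : M)
    {y : RSpace n} (hy : y ∈ (extChartAt (𝓡 n) x).target) :
    ContDiffAt ℝ ∞ (fderiv ℝ (inChart F x)) y :=
  (contDiffAt_inChart hF.smooth x hy).fderiv_right (by simp)

variable [IsRiemannianManifold (𝓡 n) M]

/-- The inverse chart maps the segment to a path whose Riemannian speed is the norm of the
derivative of `F` in the chart applied to `w`, since `F` is isometric. Its length is then at most
`c`. -/
theorem IsIsometricImmersion.edist_symm_le (hF : IsIsometricImmersion F) (x : M)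
    {y w : RSpace n} {c : ℝ}
    (ht : ∀ s ∈ Set.Icc (0 : ℝ) 1, y + s • w ∈ (extChartAt (𝓡 n) x).target)
    (hc : ∀ s ∈ Set.Icc (0 : ℝ) 1, ‖fderiv ℝ (inChart F x) (y + s • w) w‖ ≤ c) :
    edist ((extChartAt (𝓡 n) x).symm y) ((extChartAt (𝓡 n) x).symm (y + w)) ≤
      ENNReal.ofReal c := by
  set l : ℝ → RSpace n := fun s => y + s • w with hl
  have hlc : ContDiff ℝ 1 l := by fun_prop
  have hld : ∀ s, HasDerivAt l w s := fun s => by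
    have h := ((hasDerivAt_id s).smul_const w).const_add y
    rw [one_smul] at h
    exact h
  set γ : ℝ → M := (extChartAt (𝓡 n) x).symm ∘ l with hγ
  have hsm : ContMDiffOn 𝓘(ℝ, ℝ) (𝓡 n) 1 γ (Set.Icc 0 1) :=
    (contMDiffOn_extChartAt_symm x).comp hlc.contMDiff.contMDiffOn ht
  rw [IsRiemannianManifold.out (I := 𝓡 n)]
  refine (riemannianEDist_le_pathELength hsm (by simp [hγ, hl]) (by simp [hγ, hl])
    zero_le_one).trans ?_
  rw [pathELength_eq_lintegral_mfderiv_Icc]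
  have hb : ∀ s ∈ Set.Icc (0 : ℝ) 1,
      ‖mfderiv 𝓘(ℝ, ℝ) (𝓡 n) γ s (1 : ℝ)‖ₑ ≤ ENNReal.ofReal c := fun s hs => by
    have h1 : mfderiv 𝓘(ℝ, ℝ) (𝓡 n) γ s (1 : ℝ) = chartFrame x (l s) w := by
      have h := mfderiv_comp s (mdifferentiableAt_symm x (ht s hs))
        (hlc.contMDiff.mdifferentiableAt one_ne_zero (x := s))
      have hl1 : mfderiv 𝓘(ℝ, ℝ) 𝓘(ℝ, RSpace n) l s (1 : ℝ) = w := by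
        rw [mfderiv_eq_fderiv]
        exact fderiv_apply_one_eq_deriv.trans (hld s).deriv
      calc mfderiv 𝓘(ℝ, ℝ) (𝓡 n) γ s (1 : ℝ) =
          chartFrame x (l s) (mfderiv 𝓘(ℝ, ℝ) 𝓘(ℝ, RSpace n) l s (1 : ℝ)) := by
            rw [hγ, h]
            rfl
        _ = chartFrame x (l s) w := by rw [hl1]
    rw [h1]
    refine (hF.enorm_differential _ (chartFrame x (l s) w)).symm.le.trans ?_
    rw [← hF.fderiv_inChart_apply x (ht s hs), ← ofReal_norm]
    exact ENNReal.ofReal_le_ofReal (hc s hs)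
  calc _ ≤ ∫⁻ _ in Set.Icc (0 : ℝ) 1, ENNReal.ofReal c :=
        setLIntegral_mono' measurableSet_Icc hb
    _ = ENNReal.ofReal c := by simp

/-- An isometric immersion does not increase distances. -/
theorem IsIsometricImmersion.lipschitzWith_one (hF : IsIsometricImmersion F) :
    LipschitzWith 1 F := by
  intro p q
  rw [ENNReal.coe_one, one_mul]
  rw [IsRiemannianManifold.out (I := 𝓡 n) p q]
  refine le_of_forall_gt fun r hr => ?_
  obtain ⟨γ, h0, h1, hγ, hL⟩ := exists_lt_of_riemannianEDist_lt hr
  refine lt_of_le_of_lt ?_ hL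
  have hsm : ContDiffOn ℝ 1 (F ∘ γ) (Set.Icc 0 1) := by
    rw [← contMDiffOn_iff_contDiffOn]
    exact (hF.smooth.of_le (by simp)).comp_contMDiffOn hγ
  rw [← h0, ← h1, pathELength_eq_lintegral_mfderivWithin_Icc, edist_comm, edist_eq_enorm_sub]
  -- The chord in `ℂⁿ` is at most the length of the image path `F ∘ γ`, which equals the length of
  -- `γ`.
  refine (enorm_sub_le_lintegral_derivWithin_Icc_of_contDiffOn_Icc hsm zero_le_one).trans ?_
  refine setLIntegral_mono' measurableSet_Icc fun s hs => ?_
  have h := mfderivWithin_comp s (s := Set.Icc (0 : ℝ) 1) (u := Set.univ) (I := 𝓘(ℝ, ℝ)) (I' := 𝓡 n)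
    (I'' := 𝓘(ℝ, CSpace n)) (f := γ) (g := F)
    (hF.smooth.mdifferentiable (by simp) _).mdifferentiableWithinAt
    (hγ.mdifferentiableOn one_ne_zero s hs) (fun _ _ => trivial)
    (uniqueMDiffWithinAt_iff_uniqueDiffWithinAt.2 (uniqueDiffOn_Icc zero_lt_one s hs))
  rw [mfderivWithin_univ, mfderivWithin_eq_fderivWithin] at h
  have h2 : derivWithin (F ∘ γ) (Set.Icc 0 1) s =
      differential F (γ s) (mfderivWithin 𝓘(ℝ, ℝ) (𝓡 n) γ (Set.Icc 0 1) s (1 : ℝ)) := by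
    rw [← fderivWithin_derivWithin, h]
    rfl
  rw [h2]
  exact (hF.enorm_differential _ _).le

end Charts

/-! ### Chart independence of the mean curvature, and `div X = |H|²`. -/

section MeanCurvature

open Filter Topology Manifold
open scoped NNReal ENNReal

variable {n : ℕ} {M : Type*} [EMetricSpace M] [ChartedSpace (RSpace n) M] [IsManifold (𝓡 n) ∞ M]

/-- The non-tensorial second term lies in the range of the first derivative of `G`. For a change of
chart it is thus tangent to the immersion and disappears under normal projection. -/
theorem fderiv_fderiv_comp_apply {V W E : Type*} [NormedAddCommGroup V] [NormedSpace ℝ V]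
    [NormedAddCommGroup W] [NormedSpace ℝ W] [NormedAddCommGroup E] [NormedSpace ℝ E]
    {G : W → E} {τ : V → W} {y : V} (hG : ContDiffAt ℝ 2 G (τ y)) (hτ : ContDiffAt ℝ 2 τ y)
    (v w : V) :
    fderiv ℝ (fderiv ℝ (G ∘ τ)) y v w =
      fderiv ℝ (fderiv ℝ G) (τ y) (fderiv ℝ τ y v) (fderiv ℝ τ y w) +
        fderiv ℝ G (τ y) (fderiv ℝ (fderiv ℝ τ) y v w) := by
  have h1 : fderiv ℝ (G ∘ τ) =ᶠ[𝓝 y] fun z => (fderiv ℝ G (τ z)).comp (fderiv ℝ τ z) := by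
    have hGe : ∀ᶠ z in 𝓝 y, DifferentiableAt ℝ G (τ z) :=
      hτ.continuousAt.eventually ((hG.eventually (by simp)).mono fun z hz =>
        hz.differentiableAt two_ne_zero)
    have hτe : ∀ᶠ z in 𝓝 y, DifferentiableAt ℝ τ z :=
      (hτ.eventually (by simp)).mono fun z hz => hz.differentiableAt two_ne_zero
    filter_upwards [hGe, hτe] with z hz hz'
    exact fderiv_comp z hz hz'
  have hG' : HasFDerivAt (fderiv ℝ G) (fderiv ℝ (fderiv ℝ G) (τ y)) (τ y) :=
    ((hG.fderiv_right (m := 1) (by norm_num)).differentiableAt one_ne_zero).hasFDerivAt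
  have hτ' : HasFDerivAt (fderiv ℝ τ) (fderiv ℝ (fderiv ℝ τ) y) y :=
    ((hτ.fderiv_right (m := 1) (by norm_num)).differentiableAt one_ne_zero).hasFDerivAt
  have h2 := (hG'.comp y (hτ.differentiableAt two_ne_zero).hasFDerivAt).clm_comp hτ'
  have h3 : fderiv ℝ (fderiv ℝ (G ∘ τ)) y = _ := h1.fderiv_eq.trans h2.fderiv
  rw [h3]
  simp [add_comm]

/-- The transition map from the chart at `x` to the chart at `p`. -/
def transition (x p : M) : RSpace n → RSpace n :=
  extChartAt (𝓡 n) p ∘ (extChartAt (𝓡 n) x).symm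

theorem contDiffAt_transition (x p : M) {y : RSpace n} (hy : y ∈ (extChartAt (𝓡 n) x).target)
    (hp : (extChartAt (𝓡 n) x).symm y ∈ (extChartAt (𝓡 n) p).source) :
    ContDiffAt ℝ ∞ (transition x p) y := by
  rw [← contMDiffAt_iff_contDiffAt]
  refine ContMDiffAt.comp (I' := 𝓡 n) y (contMDiffAt_extChartAt' ?_)
    ((contMDiffOn_extChartAt_symm x).contMDiffAt ((isOpen_target x).mem_nhds hy))
  rwa [extChartAt_source] at hp

theorem eventually_symm_mem_source (x p : M) {y : RSpace n}
    (hy : y ∈ (extChartAt (𝓡 n) x).target)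
    (hp : (extChartAt (𝓡 n) x).symm y ∈ (extChartAt (𝓡 n) p).source) :
    ∀ᶠ z in 𝓝 y, (extChartAt (𝓡 n) x).symm z ∈ (extChartAt (𝓡 n) p).source :=
  (continuousAt_extChartAt_symm'' hy).eventually ((isOpen_extChartAt_source p).mem_nhds hp)

theorem inChart_eventuallyEq_comp_transition (F : M → CSpace n) (x p : M) {y : RSpace n}
    (hy : y ∈ (extChartAt (𝓡 n) x).target)
    (hp : (extChartAt (𝓡 n) x).symm y ∈ (extChartAt (𝓡 n) p).source) :
    inChart F x =ᶠ[𝓝 y] inChart F p ∘ transition x p := by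
  filter_upwards [eventually_symm_mem_source x p hy hp] with z hz
  simp only [inChart, transition, Function.comp_apply]
  rw [(extChartAt (𝓡 n) p).left_inv hz]

variable {F : M → CSpace n} [RiemannianBundle (fun x : M => TangentSpace (𝓡 n) x)]

theorem IsIsometricImmersion.fderiv_inChart_eq_comp (hF : IsIsometricImmersion F) (x p : M)
    {y : RSpace n} (hy : y ∈ (extChartAt (𝓡 n) x).target)
    (hp : (extChartAt (𝓡 n) x).symm y ∈ (extChartAt (𝓡 n) p).source) :
    fderiv ℝ (inChart F x) y =
      (fderiv ℝ (inChart F p) (transition x p y)).comp (fderiv ℝ (transition x p) y) := by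
  rw [(inChart_eventuallyEq_comp_transition F x p hy hp).fderiv_eq]
  exact fderiv_comp y
    ((contDiffAt_inChart hF.smooth p ((extChartAt (𝓡 n) p).map_source hp)).differentiableAt
      (by simp))
    ((contDiffAt_transition x p hy hp).differentiableAt (by simp))

theorem IsIsometricImmersion.det_fderiv_transition_ne_zero (hF : IsIsometricImmersion F) (x p : M)
    {y : RSpace n} (hy : y ∈ (extChartAt (𝓡 n) x).target)
    (hp : (extChartAt (𝓡 n) x).symm y ∈ (extChartAt (𝓡 n) p).source) :
    (fderiv ℝ (transition x p) y).det ≠ 0 := by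
  intro h0
  have hker := LinearMap.bot_lt_ker_of_det_eq_zero (f := (fderiv ℝ (transition x p) y).toLinearMap)
    h0
  refine hker.ne' (LinearMap.ker_eq_bot.2 fun v w hvw => ?_)
  refine hF.fderiv_inChart_injective x hy ?_
  rw [hF.fderiv_inChart_eq_comp x p hy hp]
  exact congrArg (fderiv ℝ (inChart F p) (transition x p y)) hvw

theorem normalPart_add (x : M) (v w : CSpace n) :
    normalPart F x (v + w) = normalPart F x v + normalPart F x w := map_add _ _ _

theorem normalPart_of_mem {x : M} {v : CSpace n} (hv : v ∈ tangentPlane F x) :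
    normalPart F x v = 0 := by
  exact (Submodule.starProjection_apply_eq_zero_iff _).2 (Submodule.le_orthogonal_orthogonal _ hv)

theorem inner_normalPart_normalPart (x : M) (v w : CSpace n) :
    inner ℝ (normalPart F x v) (normalPart F x w) = inner ℝ v (normalPart F x w) := by
  rw [normalPart, Submodule.inner_starProjection_left_eq_right]
  congr 1
  exact Submodule.starProjection_eq_self_iff.2 (Submodule.starProjection_apply_mem _ _)

theorem meanCurvature_eq_normalPart_metricTrace (p : M) :
    meanCurvature F p = normalPart F p
      (metricTrace (fderiv ℝ (inChart F p) (extChartAt (𝓡 n) p p))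
        (fderiv ℝ (fderiv ℝ (inChart F p)) (extChartAt (𝓡 n) p p))) := by
  simp only [meanCurvature, secondFundamentalForm, normalPart, metricTrace, map_sum, map_smul]
  rfl

/-- The mean curvature vector can be computed in any chart. -/
theorem IsIsometricImmersion.meanCurvature_symm (hF : IsIsometricImmersion F) (x : M)
    {y : RSpace n} (hy : y ∈ (extChartAt (𝓡 n) x).target) :
    meanCurvature F ((extChartAt (𝓡 n) x).symm y) = normalPart F ((extChartAt (𝓡 n) x).symm y)
      (metricTrace (fderiv ℝ (inChart F x) y) (fderiv ℝ (fderiv ℝ (inChart F x)) y)) := by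
  set p := (extChartAt (𝓡 n) x).symm y with hpdef
  have hp : (extChartAt (𝓡 n) x).symm y ∈ (extChartAt (𝓡 n) p).source := mem_extChartAt_source p
  have hτy : transition x p y = extChartAt (𝓡 n) p p := rfl
  have htgt : transition x p y ∈ (extChartAt (𝓡 n) p).target := (extChartAt (𝓡 n) p).map_source hp
  set D := fderiv ℝ (inChart F p) (transition x p y) with hD
  set B := fderiv ℝ (fderiv ℝ (inChart F p)) (transition x p y) with hB
  set J := fderiv ℝ (transition x p) y with hJ
  have h2 : ∀ v w, fderiv ℝ (fderiv ℝ (inChart F x)) y v w =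
      B (J v) (J w) + D (fderiv ℝ (fderiv ℝ (transition x p)) y v w) := fun v w => by
    rw [(inChart_eventuallyEq_comp_transition F x p hy hp).fderiv.fderiv_eq]
    exact fderiv_fderiv_comp_apply
      ((contDiffAt_inChart hF.smooth p htgt).of_le ENat.LEInfty.out)
      ((contDiffAt_transition x p hy hp).of_le ENat.LEInfty.out) v w
  have h3 : metricTrace (fderiv ℝ (inChart F x) y) (fderiv ℝ (fderiv ℝ (inChart F x)) y) =
      metricTrace D B + D (∑ i, ∑ j, (gramMatrix (fderiv ℝ (inChart F x) y))⁻¹ i j •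
        fderiv ℝ (fderiv ℝ (transition x p)) y (stdVec i) (stdVec j)) := by
    rw [← metricTrace_comp D J (hF.det_fderiv_transition_ne_zero x p hy hp),
      hF.fderiv_inChart_eq_comp x p hy hp, metricTrace]
    simp only [h2, smul_add, Finset.sum_add_distrib, map_sum, map_smul]
    rfl
  have hmem : ∀ w, D w ∈ tangentPlane F p := fun w => by
    have h := hF.range_fderiv_inChart p htgt
    rw [hτy, extChartAt_to_inv] at h
    rw [← h]
    exact ⟨w, rfl⟩
  rw [h3, normalPart_add, normalPart_of_mem (hmem _), add_zero,
    meanCurvature_eq_normalPart_metricTrace]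
  rfl

/-- On a translating soliton, the tangential part of `T` has divergence `|H|²`. -/
theorem IsIsometricImmersion.divergence_densityField (hF : IsIsometricImmersion F) {T : CSpace n}
    (hT : ∀ p, normalPart F p T = meanCurvature F p) (x : M) {y : RSpace n}
    (hy : y ∈ (extChartAt (𝓡 n) x).target) :
    divergence (densityField (fderiv ℝ (inChart F x)) T) y =
      √(gram F x y).det * ‖meanCurvature F ((extChartAt (𝓡 n) x).symm y)‖ ^ 2 := by
  have hG : ContDiffAt ℝ ∞ (inChart F x) y := contDiffAt_inChart hF.smooth x hy
  have hD := (hF.contDiffAt_fderiv_inChart x hy).of_le (n := ∞) (m := 1) (by simp)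
  have hsymm := hG.isSymmSndFDerivAt (by simpa using ENat.LEInfty.out)
  rw [LagTranslator.divergence_densityField hD (hD.differentiableAt one_ne_zero).hasFDerivAt
    (fun v w => hsymm v w) (by
      filter_upwards [(isOpen_target x).mem_nhds hy] with z hz
      exact hF.fderiv_inChart_injective x hz) T, gram_eq_gramMatrix]
  congr 1
  -- Pairing with the normal vector `T^⊥` sees only the normal part of the trace, which is `H`; the
  -- soliton equation makes the other factor `H` too.
  rw [← hF.normalPart_eq x hy, ← inner_normalPart_normalPart, ← hF.meanCurvature_symm x hy, hT,
    real_inner_self_eq_norm_sq]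

end MeanCurvature

/-! ### The area measure: gluing, integration in a chart, positivity on open sets. -/

section AreaMeasure

open Filter Topology Manifold
open scoped NNReal ENNReal

variable {n : ℕ} {M : Type*} [EMetricSpace M] [ChartedSpace (RSpace n) M] [IsManifold (𝓡 n) ∞ M]
  [MeasurableSpace M] [BorelSpace M]

theorem measurableSet_source (x : M) : MeasurableSet (extChartAt (𝓡 n) x).source :=
  (isOpen_extChartAt_source x).measurableSet

theorem measurableSet_target (x : M) : MeasurableSet (extChartAt (𝓡 n) x).target :=
  (isOpen_target x).measurableSet

theorem measurableSet_symm_preimage_inter (x : M) {A : Set M} (hA : MeasurableSet A) :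
    MeasurableSet ((extChartAt (𝓡 n) x).symm ⁻¹' A ∩ (extChartAt (𝓡 n) x).target) := by
  have h := (continuousOn_iff_continuous_domRestrict.1
    (continuousOn_extChartAt_symm (I := 𝓡 n) x)).measurable hA
  have h' := (measurableSet_target x).subtype_image h
  convert h' using 1
  ext y
  simp [and_comm]

theorem aemeasurable_symm (x : M) {μ : Measure (RSpace n)}
    (hμ : μ ≪ volume.restrict (extChartAt (𝓡 n) x).target) :
    AEMeasurable (extChartAt (𝓡 n) x).symm μ :=
  ((continuousOn_extChartAt_symm x).aemeasurable (measurableSet_target x)).mono_ac hμ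

/-- The density of the area measure in the preferred chart at `x`. -/
def areaDensity (F : M → CSpace n) (x : M) (y : RSpace n) : ℝ := √(gram F x y).det

theorem areaDensity_nonneg (F : M → CSpace n) (x : M) (y : RSpace n) : 0 ≤ areaDensity F x y :=
  Real.sqrt_nonneg _

theorem chartArea_apply (F : M → CSpace n) (x : M) {A : Set M} (hA : MeasurableSet A) :
    chartArea F x A = ∫⁻ y in (extChartAt (𝓡 n) x).symm ⁻¹' A ∩ (extChartAt (𝓡 n) x).target,
      ENNReal.ofReal (areaDensity F x y) := by
  rw [chartArea, Measure.map_apply_of_aemeasurable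
    (aemeasurable_symm x (withDensity_absolutelyContinuous _ _)) hA, withDensity_apply',
    Measure.restrict_restrict' (measurableSet_target x)]
  rfl

theorem chartArea_compl_source (F : M → CSpace n) (x : M) :
    chartArea F x (extChartAt (𝓡 n) x).sourceᶜ = 0 := by
  rw [chartArea_apply F x (measurableSet_source x).compl]
  have : (extChartAt (𝓡 n) x).symm ⁻¹' (extChartAt (𝓡 n) x).sourceᶜ ∩
      (extChartAt (𝓡 n) x).target = ∅ := by
    ext y
    simp only [Set.mem_inter_iff, Set.mem_preimage, Set.mem_compl_iff, Set.mem_empty_iff_false,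
      iff_false, not_and]
    exact fun h hy => h ((extChartAt (𝓡 n) x).map_target hy)
  rw [this, Measure.restrict_empty, lintegral_zero_measure]

variable {F : M → CSpace n} [RiemannianBundle (fun x : M => TangentSpace (𝓡 n) x)]

theorem IsIsometricImmersion.areaDensity_pos (hF : IsIsometricImmersion F) (x : M)
    {y : RSpace n} (hy : y ∈ (extChartAt (𝓡 n) x).target) : 0 < areaDensity F x y :=
  Real.sqrt_pos.2 (gramMatrix_det_pos (hF.fderiv_inChart_injective x hy))

theorem IsIsometricImmersion.contDiffAt_areaDensity (hF : IsIsometricImmersion F) (x : M)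
    {y : RSpace n} (hy : y ∈ (extChartAt (𝓡 n) x).target) :
    ContDiffAt ℝ ∞ (areaDensity F x) y :=
  contDiffAt_sqrt_det_gramMatrix (hF.contDiffAt_fderiv_inChart x hy)
    (hF.fderiv_inChart_injective x hy)

theorem IsIsometricImmersion.continuousOn_areaDensity (hF : IsIsometricImmersion F) (x : M) :
    ContinuousOn (areaDensity F x) (extChartAt (𝓡 n) x).target := fun _ hy =>
  (hF.contDiffAt_areaDensity x hy).continuousAt.continuousWithinAt

/-- The chart measures agree on the overlaps of the chart domains. -/
theorem IsIsometricImmersion.chartArea_inter_source_le (hF : IsIsometricImmersion F) (x p : M)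
    {A : Set M} (hA : MeasurableSet A) :
    chartArea F p (A ∩ (extChartAt (𝓡 n) x).source) ≤ chartArea F x A := by
  rw [chartArea_apply F p (hA.inter (measurableSet_source x)), chartArea_apply F x hA]
  set s := (extChartAt (𝓡 n) x).symm ⁻¹' (A ∩ (extChartAt (𝓡 n) p).source) ∩
    (extChartAt (𝓡 n) x).target with hs
  have hsm : MeasurableSet s :=
    measurableSet_symm_preimage_inter x (hA.inter (measurableSet_source p))
  have himg : (extChartAt (𝓡 n) p).symm ⁻¹' (A ∩ (extChartAt (𝓡 n) x).source) ∩
      (extChartAt (𝓡 n) p).target = transition x p '' s := by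
    ext z
    constructor
    · rintro ⟨⟨hzA, hzx⟩, hz⟩
      refine ⟨transition p x z, ⟨⟨?_, ?_⟩, (extChartAt (𝓡 n) x).map_source hzx⟩, ?_⟩
      · simpa only [Set.mem_preimage, transition, Function.comp_apply,
          (extChartAt (𝓡 n) x).left_inv hzx] using hzA
      · simpa only [Set.mem_preimage, transition, Function.comp_apply,
          (extChartAt (𝓡 n) x).left_inv hzx] using (extChartAt (𝓡 n) p).map_target hz
      · simp only [transition, Function.comp_apply]
        rw [(extChartAt (𝓡 n) x).left_inv hzx, (extChartAt (𝓡 n) p).right_inv hz]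
    · rintro ⟨y, ⟨⟨hyA, hyp⟩, hy⟩, rfl⟩
      refine ⟨⟨?_, ?_⟩, (extChartAt (𝓡 n) p).map_source hyp⟩
      · simpa only [Set.mem_preimage, transition, Function.comp_apply,
          (extChartAt (𝓡 n) p).left_inv hyp] using hyA
      · simpa only [Set.mem_preimage, transition, Function.comp_apply,
          (extChartAt (𝓡 n) p).left_inv hyp] using (extChartAt (𝓡 n) x).map_target hy
  have hinj : Set.InjOn (transition x p) s := by
    rintro y ⟨⟨-, hyp⟩, hy⟩ z ⟨⟨-, hzp⟩, hz⟩ h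
    have h' := (extChartAt (𝓡 n) p).injOn hyp hzp h
    rw [← (extChartAt (𝓡 n) x).right_inv hy, h', (extChartAt (𝓡 n) x).right_inv hz]
  -- Change of variables along the transition map; its Jacobian is exactly the ratio of the two
  -- densities.
  rw [himg, lintegral_image_eq_lintegral_abs_det_fderiv_mul volume hsm
    (fun y hy => ((contDiffAt_transition x p hy.2 hy.1.2).differentiableAt
      (by simp)).hasFDerivAt.hasFDerivWithinAt) hinj]
  calc _ = ∫⁻ y in s, ENNReal.ofReal (areaDensity F x y) := by
        refine setLIntegral_congr_fun hsm fun y hy => ?_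
        simp only [areaDensity, gram_eq_gramMatrix]
        rw [← ENNReal.ofReal_mul (abs_nonneg _), hF.fderiv_inChart_eq_comp x p hy.2 hy.1.2,
          sqrt_det_gramMatrix_comp]
    _ ≤ _ := lintegral_mono_set (Set.inter_subset_inter_left _
        (Set.preimage_mono Set.inter_subset_left))

theorem chartArea_le_areaMeasure (F : M → CSpace n) (x : M) :
    chartArea F x ≤ areaMeasure F := le_iSup (chartArea F) x

/-- On the domain of a chart, the area measure is given by the density `√(det g)`. -/
theorem IsIsometricImmersion.areaMeasure_restrict_source (hF : IsIsometricImmersion F) (x : M) :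
    (areaMeasure F).restrict (extChartAt (𝓡 n) x).source = chartArea F x := by
  have hS := measurableSet_source (n := n) x
  set S := (extChartAt (𝓡 n) x).source with hSdef
  -- The right side dominates every chart measure: off `S` by the supremum, on `S` by the overlap
  -- comparison. Hence it dominates their least upper bound, and on `S` only `chartArea F x`
  -- remains.
  have hle : areaMeasure F ≤ (areaMeasure F).restrict Sᶜ + chartArea F x := by
    refine iSup_le fun p => Measure.le_iff.2 fun A hA => ?_
    rw [Measure.add_apply, Measure.restrict_apply hA, ← measure_inter_add_sdiff A hS,
      add_comm]
    exact add_le_add (chartArea_le_areaMeasure F p _) (hF.chartArea_inter_source_le x p hA)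
  refine le_antisymm (Measure.le_iff.2 fun A hA => ?_) (Measure.le_iff.2 fun A hA => ?_)
  · rw [Measure.restrict_apply hA]
    refine (hle _).trans ?_
    rw [Measure.add_apply, Measure.restrict_apply (hA.inter hS), Set.inter_assoc,
      Set.inter_compl_self, Set.inter_empty, measure_empty, zero_add]
    exact measure_mono Set.inter_subset_left
  · rw [Measure.restrict_apply hA, ← measure_inter_add_sdiff A hS]
    have h0 : chartArea F x (A \ S) = 0 :=
      measure_mono_null (fun z hz => hz.2) (chartArea_compl_source F x)
    rw [h0, add_zero]
    exact chartArea_le_areaMeasure F x _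

theorem IsIsometricImmersion.integral_areaMeasure (hF : IsIsometricImmersion F) (x : M)
    {f : M → ℝ} (hf : AEStronglyMeasurable f (areaMeasure F))
    (hfx : ∀ p ∉ (extChartAt (𝓡 n) x).source, f p = 0) :
    ∫ p, f p ∂(areaMeasure F) =
      ∫ y in (extChartAt (𝓡 n) x).target,
        areaDensity F x y * f ((extChartAt (𝓡 n) x).symm y) := by
  rw [← setIntegral_eq_integral_of_forall_compl_eq_zero hfx, hF.areaMeasure_restrict_source x]
  have hf' := hf.mono_measure (chartArea_le_areaMeasure F x)
  have hdens : AEMeasurable (fun y => ENNReal.ofReal (√(gram F x y).det))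
      (volume.restrict (extChartAt (𝓡 n) x).target) :=
    ((hF.continuousOn_areaDensity x).aemeasurable (measurableSet_target x)).ennreal_ofReal
  rw [chartArea, integral_map (aemeasurable_symm x (withDensity_absolutelyContinuous _ _)) hf',
    integral_withDensity_eq_integral_toReal_smul₀ hdens (ae_of_all _ fun _ => ENNReal.ofReal_lt_top)]
  refine integral_congr_ae (ae_of_all _ fun y => ?_)
  simp only [smul_eq_mul, ENNReal.toReal_ofReal (Real.sqrt_nonneg _)]
  rfl

theorem IsIsometricImmersion.areaMeasure_pos (hF : IsIsometricImmersion F) {O : Set M}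
    (hO : IsOpen O) {x : M} (hx : x ∈ O) : 0 < areaMeasure F O := by
  refine lt_of_lt_of_le ?_ (chartArea_le_areaMeasure F x O)
  rw [chartArea_apply F x hO.measurableSet, Set.inter_comm, pos_iff_ne_zero]
  set V := (extChartAt (𝓡 n) x).target ∩ (extChartAt (𝓡 n) x).symm ⁻¹' O with hV
  have hVo : IsOpen V :=
    (continuousOn_extChartAt_symm x).isOpen_inter_preimage (isOpen_target x) hO
  have hVx : extChartAt (𝓡 n) x x ∈ V :=
    ⟨mem_extChartAt_target x, by simpa using hx⟩
  intro h0
  have hm : AEMeasurable (fun y => ENNReal.ofReal (areaDensity F x y)) (volume.restrict V) :=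
    (((hF.continuousOn_areaDensity x).mono Set.inter_subset_left).aemeasurable
      hVo.measurableSet).ennreal_ofReal
  rw [lintegral_eq_zero_iff' hm, EventuallyEq, ae_restrict_iff' hVo.measurableSet] at h0
  have : volume V = 0 := by
    refine measure_mono_null (fun y hy => ?_) (ae_iff.1 h0)
    simp only [Set.mem_ofPred_eq, Classical.not_imp]
    exact ⟨hy, by simpa using hF.areaDensity_pos x hy.1⟩
  exact (hVo.measure_pos volume ⟨_, hVx⟩).ne' this

end AreaMeasure

/-! ### The tangential field `X` and gradient bounds for Lipschitz functions. -/

section LocalEstimates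

open Filter Topology Manifold
open scoped NNReal ENNReal

variable {n : ℕ} {M : Type*} [EMetricSpace M] [ChartedSpace (RSpace n) M] [IsManifold (𝓡 n) ∞ M]

theorem continuous_of_continuousOn_charts {V : Type*} [TopologicalSpace V] {f : M → V}
    (hf : ∀ x, ContinuousOn (f ∘ (extChartAt (𝓡 n) x).symm) (extChartAt (𝓡 n) x).target) :
    Continuous f := by
  refine continuous_iff_continuousAt.2 fun x => ?_
  have h1 : ContinuousAt (f ∘ (extChartAt (𝓡 n) x).symm) (extChartAt (𝓡 n) x x) :=
    (hf x).continuousAt ((isOpen_target x).mem_nhds (mem_extChartAt_target x))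
  have h2 : ContinuousAt ((f ∘ (extChartAt (𝓡 n) x).symm) ∘ extChartAt (𝓡 n) x) x :=
    ContinuousAt.comp h1 (continuousAt_extChartAt x)
  refine h2.congr ?_
  filter_upwards [extChartAt_source_mem_nhds (I := 𝓡 n) x] with z hz
  rw [Function.comp_apply, Function.comp_apply, (extChartAt (𝓡 n) x).left_inv hz]

variable {F : M → CSpace n} [RiemannianBundle (fun x : M => TangentSpace (𝓡 n) x)]

/-- The field is selected pointwise, without regularity. For an isometric immersion it is unique,
and `chartFrame_tangentCoeff` identifies it with a smooth expression in each chart. -/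
theorem exists_differential_eq_sub_normalPart (F : M → CSpace n) (T : CSpace n) :
    ∃ X : ∀ p : M, TangentSpace (𝓡 n) p, ∀ p, differential F p (X p) = T - normalPart F p T := by
  have h : ∀ p : M, ∃ v : TangentSpace (𝓡 n) p, differential F p v = T - normalPart F p T := by
    intro p
    have hmem : T - normalPart F p T ∈ tangentPlane F p := by
      rw [normalPart, Submodule.starProjection_orthogonal]
      simp
    exact hmem
  exact ⟨fun p => (h p).choose, fun p => (h p).choose_spec⟩

variable {T : CSpace n} {X : ∀ p : M, TangentSpace (𝓡 n) p}

theorem IsIsometricImmersion.chartFrame_tangentCoeff (hF : IsIsometricImmersion F)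
    (hX : ∀ p, differential F p (X p) = T - normalPart F p T) (x : M) {y : RSpace n}
    (hy : y ∈ (extChartAt (𝓡 n) x).target) :
    chartFrame x y (tangentCoeff (fderiv ℝ (inChart F x) y) T) =
      X ((extChartAt (𝓡 n) x).symm y) := by
  refine hF.differential_injective _ ?_
  rw [← hF.fderiv_inChart_apply x hy, hX, hF.normalPart_eq x hy, sub_sub_cancel]

/-- The derivative of a function along a vector field. -/
def derivAlong (X : ∀ p : M, TangentSpace (𝓡 n) p) (f : M → ℝ) (p : M) : ℝ :=
  mfderiv (𝓡 n) 𝓘(ℝ, ℝ) f p (X p)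

theorem derivAlong_const (X : ∀ p : M, TangentSpace (𝓡 n) p) (c : ℝ) (p : M) :
    derivAlong X (fun _ => c) p = 0 := by
  rw [derivAlong, mfderiv_const]
  rfl

theorem derivAlong_congr {f g : M → ℝ} {p : M} (h : f =ᶠ[𝓝 p] g) :
    derivAlong X f p = derivAlong X g p := by
  unfold derivAlong
  rw [h.mfderiv_eq]
  rfl

theorem IsIsometricImmersion.derivAlong_symm (hF : IsIsometricImmersion F)
    (hX : ∀ p, differential F p (X p) = T - normalPart F p T) {ρ : M → ℝ}
    (hρ : ContMDiff (𝓡 n) 𝓘(ℝ, ℝ) ∞ ρ) (x : M) {y : RSpace n}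
    (hy : y ∈ (extChartAt (𝓡 n) x).target) :
    derivAlong X ρ ((extChartAt (𝓡 n) x).symm y) =
      fderiv ℝ (ρ ∘ (extChartAt (𝓡 n) x).symm) y
        (tangentCoeff (fderiv ℝ (inChart F x) y) T) := by
  rw [fderiv_comp_symm_apply hρ x hy, hF.chartFrame_tangentCoeff hX x hy, derivAlong]

theorem IsIsometricImmersion.contDiffAt_tangentCoeff (hF : IsIsometricImmersion F) (T : CSpace n)
    (x : M) {y : RSpace n} (hy : y ∈ (extChartAt (𝓡 n) x).target) :
    ContDiffAt ℝ ∞ (fun z => tangentCoeff (fderiv ℝ (inChart F x) z) T) y :=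
  LagTranslator.contDiffAt_tangentCoeff (hF.contDiffAt_fderiv_inChart x hy)
    (hF.fderiv_inChart_injective x hy) T

theorem IsIsometricImmersion.continuous_derivAlong (hF : IsIsometricImmersion F)
    (hX : ∀ p, differential F p (X p) = T - normalPart F p T) {ρ : M → ℝ}
    (hρ : ContMDiff (𝓡 n) 𝓘(ℝ, ℝ) ∞ ρ) :
    Continuous (derivAlong X ρ) := by
  refine continuous_of_continuousOn_charts (n := n) fun x => ?_
  have h : ContinuousOn (fun y => fderiv ℝ (ρ ∘ (extChartAt (𝓡 n) x).symm) y
        (tangentCoeff (fderiv ℝ (inChart F x) y) T)) (extChartAt (𝓡 n) x).target := by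
    intro y hy
    have h1 : ContDiffAt ℝ ∞ (fderiv ℝ (ρ ∘ (extChartAt (𝓡 n) x).symm)) y :=
      (contDiffAt_inChart hρ x hy).fderiv_right (by simp)
    exact (h1.clm_apply (hF.contDiffAt_tangentCoeff T x hy)).continuousAt.continuousWithinAt
  exact h.congr fun y hy => hF.derivAlong_symm hX hρ x hy

theorem IsIsometricImmersion.continuous_normalPart (hF : IsIsometricImmersion F) (T : CSpace n) :
    Continuous fun p => normalPart F p T := by
  refine continuous_of_continuousOn_charts (n := n) fun x => ?_
  have h : ContinuousOn (fun y => T - fderiv ℝ (inChart F x) y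
        (tangentCoeff (fderiv ℝ (inChart F x) y) T)) (extChartAt (𝓡 n) x).target := by
    intro y hy
    exact (contDiffAt_const.sub ((hF.contDiffAt_fderiv_inChart x hy).clm_apply
      (hF.contDiffAt_tangentCoeff T x hy))).continuousAt.continuousWithinAt
  exact h.congr fun y hy => hF.normalPart_eq x hy T

theorem IsIsometricImmersion.norm_fderiv_tangentCoeff_le (hF : IsIsometricImmersion F)
    (T : CSpace n) (x : M) {y : RSpace n} (hy : y ∈ (extChartAt (𝓡 n) x).target) :
    ‖fderiv ℝ (inChart F x) y (tangentCoeff (fderiv ℝ (inChart F x) y) T)‖ ≤ ‖T‖ := by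
  rw [map_tangentCoeff (hF.fderiv_inChart_injective x hy)]
  exact Submodule.norm_starProjection_apply_le _ _

variable [IsRiemannianManifold (𝓡 n) M]

/-- The inverse of a chart is Lipschitz near the centre of the chart. -/
theorem IsIsometricImmersion.exists_lipschitzOnWith_symm (hF : IsIsometricImmersion F) (x : M) :
    ∃ r > 0, Metric.closedBall (extChartAt (𝓡 n) x x) r ⊆ (extChartAt (𝓡 n) x).target ∧
      ∃ C, LipschitzOnWith C (extChartAt (𝓡 n) x).symm
        (Metric.ball (extChartAt (𝓡 n) x x) r) := by
  obtain ⟨r, hr, hsub⟩ := Metric.nhds_basis_closedBall.mem_iff.1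
    ((isOpen_target x).mem_nhds (mem_extChartAt_target (I := 𝓡 n) x))
  refine ⟨r, hr, hsub, ?_⟩
  have hcont : ContinuousOn (fun y => ‖fderiv ℝ (inChart F x) y‖)
      (Metric.closedBall (extChartAt (𝓡 n) x x) r) := fun y hy =>
    (hF.contDiffAt_fderiv_inChart x (hsub hy)).continuousAt.norm.continuousWithinAt
  obtain ⟨C, hC⟩ := (isCompact_closedBall _ _).bddAbove_image hcont
  refine ⟨C.toNNReal, fun y hy z hz => ?_⟩
  have hseg : ∀ s ∈ Set.Icc (0 : ℝ) 1, y + s • (z - y) ∈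
      Metric.closedBall (extChartAt (𝓡 n) x x) r := fun s hs =>
    Metric.ball_subset_closedBall ((convex_ball _ _).add_smul_sub_mem hy hz hs)
  have h := hF.edist_symm_le x (y := y) (w := z - y) (c := C * ‖z - y‖)
    (fun s hs => hsub (hseg s hs)) fun s hs =>
      (ContinuousLinearMap.le_opNorm _ _).trans
        (mul_le_mul_of_nonneg_right (hC ⟨_, hseg s hs, rfl⟩) (norm_nonneg _))
  rw [add_sub_cancel] at h
  refine h.trans (le_of_eq ?_)
  rw [ENNReal.ofReal_mul' (norm_nonneg _), edist_comm, edist_eq_enorm_sub, ofReal_norm]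
  rfl

/-- An `L`-Lipschitz function has Riemannian gradient at most `L`. The vector `w` is measured in the
induced metric, so no constant of the chart enters; the final doubling argument needs the exact `L`.
For any `c` above the norm at `y`, continuity bounds the speed of short segments by `c`, and then
`c` decreases to that norm. -/
theorem IsIsometricImmersion.abs_fderiv_comp_symm_le (hF : IsIsometricImmersion F) {φ : M → ℝ}
    {L : ℝ≥0} (hφ : LipschitzWith L φ) (x : M) {y : RSpace n}
    (hy : y ∈ (extChartAt (𝓡 n) x).target)
    (hd : DifferentiableAt ℝ (φ ∘ (extChartAt (𝓡 n) x).symm) y) (w : RSpace n) :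
    |fderiv ℝ (φ ∘ (extChartAt (𝓡 n) x).symm) y w| ≤ L * ‖fderiv ℝ (inChart F x) y w‖ := by
  have key : ∀ c > ‖fderiv ℝ (inChart F x) y w‖,
      |fderiv ℝ (φ ∘ (extChartAt (𝓡 n) x).symm) y w| ≤ L * c := by
    intro c hc
    have hc0 : 0 ≤ c := (norm_nonneg _).trans hc.le
    have hev : ∀ᶠ z in 𝓝 y, z ∈ (extChartAt (𝓡 n) x).target ∧
        ‖fderiv ℝ (inChart F x) z w‖ < c := by
      refine Filter.Eventually.and ((isOpen_target x).mem_nhds hy) ?_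
      have : ContinuousAt (fun z => ‖fderiv ℝ (inChart F x) z w‖) y :=
        (((hF.contDiffAt_fderiv_inChart x hy).clm_apply contDiffAt_const).continuousAt).norm
      exact this.eventually_lt_const hc
    obtain ⟨ε, hε, hball⟩ := Metric.eventually_nhds_iff_ball.1 hev
    have hline : HasDerivAt (fun t : ℝ => y + t • w) w 0 := by
      have h := ((hasDerivAt_id (0 : ℝ)).smul_const w).const_add y
      rw [one_smul] at h
      exact h
    have h0 : y + (0 : ℝ) • w = y := by simp
    have hder : HasDerivAt (fun t : ℝ => (φ ∘ (extChartAt (𝓡 n) x).symm) (y + t • w))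
        (fderiv ℝ (φ ∘ (extChartAt (𝓡 n) x).symm) y w) 0 := by
      have h : HasFDerivAt (φ ∘ (extChartAt (𝓡 n) x).symm)
        (fderiv ℝ (φ ∘ (extChartAt (𝓡 n) x).symm) y) (y + (0 : ℝ) • w) := by
          rw [h0]; exact hd.hasFDerivAt
      exact h.comp_hasDerivAt (0 : ℝ) hline
    refine hder.le_of_lip' (by positivity) ?_
    have hmem : ∀ᶠ t in 𝓝 (0 : ℝ), y + t • w ∈ Metric.ball y ε := by
      refine hline.continuousAt.eventually ?_
      simp only [h0]
      exact Metric.ball_mem_nhds y hε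
    filter_upwards [hmem] with t ht
    have hseg : ∀ s ∈ Set.Icc (0 : ℝ) 1, y + s • (t • w) ∈ Metric.ball y ε := fun s hs => by
      have := (convex_ball y ε).add_smul_sub_mem (Metric.mem_ball_self hε) ht hs
      rwa [add_sub_cancel_left] at this
    have h := hF.edist_symm_le x (y := y) (w := t • w) (c := |t| * c)
      (fun s hs => (hball _ (hseg s hs)).1) fun s hs => by
        rw [map_smul, norm_smul, Real.norm_eq_abs]
        exact mul_le_mul_of_nonneg_left (hball _ (hseg s hs)).2.le (abs_nonneg t)
    have h2 := (hφ ((extChartAt (𝓡 n) x).symm y) ((extChartAt (𝓡 n) x).symm (y + t • w))).trans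
      (mul_le_mul_right h (L : ℝ≥0∞))
    rw [edist_comm, edist_dist, ← ENNReal.ofReal_coe_nnreal, ← ENNReal.ofReal_mul L.coe_nonneg,
      ENNReal.ofReal_le_ofReal_iff (by positivity), Real.dist_eq] at h2
    simp only [Function.comp_apply, zero_smul, add_zero, sub_zero, Real.norm_eq_abs]
    linarith
  -- The limit in `c` is taken after dividing by `L`, so `L = 0` is separate.
  rcases eq_or_lt_of_le L.coe_nonneg with hL | hL
  · have := key (‖fderiv ℝ (inChart F x) y w‖ + 1) (by linarith)
    rw [← hL] at this ⊢
    simpa using this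
  · rw [← div_le_iff₀' hL]
    refine le_of_forall_gt_imp_ge_of_dense fun c hc => ?_
    rw [div_le_iff₀' hL]
    exact key c hc

end LocalEstimates

/-! ### The energy estimate in a single chart. -/

section ChartEstimate

open Filter Topology Manifold
open scoped NNReal ENNReal

variable {n : ℕ} {M : Type*} [EMetricSpace M] [ChartedSpace (RSpace n) M] [IsManifold (𝓡 n) ∞ M]
  [MeasurableSpace M] [BorelSpace M]
  {F : M → CSpace n} [RiemannianBundle (fun x : M => TangentSpace (𝓡 n) x)]
  {T : CSpace n} {X : ∀ p : M, TangentSpace (𝓡 n) p}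

/-- The function on `ℝⁿ` obtained from a function on the domain of the chart at `x`. -/
def pullToChart (x : M) (f : M → ℝ) : RSpace n → ℝ :=
  (extChartAt (𝓡 n) x).target.indicator (f ∘ (extChartAt (𝓡 n) x).symm)

theorem pullToChart_of_mem {x : M} {y : RSpace n} (hy : y ∈ (extChartAt (𝓡 n) x).target)
    (f : M → ℝ) : pullToChart x f y = f ((extChartAt (𝓡 n) x).symm y) :=
  Set.indicator_of_mem hy _

theorem pullToChart_of_notMem {x : M} {y : RSpace n} (hy : y ∉ (extChartAt (𝓡 n) x).target)
    (f : M → ℝ) : pullToChart x f y = 0 :=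
  Set.indicator_of_notMem hy _

theorem pullToChart_eventuallyEq {x : M} {y : RSpace n} (hy : y ∈ (extChartAt (𝓡 n) x).target)
    (f : M → ℝ) : pullToChart x f =ᶠ[𝓝 y] f ∘ (extChartAt (𝓡 n) x).symm := by
  filter_upwards [(isOpen_target x).mem_nhds hy] with z hz
  exact pullToChart_of_mem hz f

theorem pullToChart_eq_zero {x : M} {f : M → ℝ} {y : RSpace n}
    (hy : y ∉ extChartAt (𝓡 n) x '' tsupport f) : pullToChart x f y = 0 := by
  by_cases hyt : y ∈ (extChartAt (𝓡 n) x).target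
  · rw [pullToChart_of_mem hyt]
    by_contra h
    exact hy ⟨_, subset_tsupport f h, (extChartAt (𝓡 n) x).right_inv hyt⟩
  · exact pullToChart_of_notMem hyt f

/-- The extension by zero is smooth across the boundary of the chart target because the support has
compact image inside the target. `W` may therefore be arbitrary outside. -/
theorem contDiff_pullToChart_smul {x : M} {f : M → ℝ} (hf : ContMDiff (𝓡 n) 𝓘(ℝ, ℝ) ∞ f)
    (hfc : HasCompactSupport f) (hfx : tsupport f ⊆ (extChartAt (𝓡 n) x).source)
    {V : Type*} [NormedAddCommGroup V] [NormedSpace ℝ V] {W : RSpace n → V}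
    (hW : ∀ y ∈ (extChartAt (𝓡 n) x).target, ContDiffAt ℝ ∞ W y) :
    ContDiff ℝ ∞ (fun y => pullToChart x f y • W y) := by
  have hK : IsCompact (extChartAt (𝓡 n) x '' tsupport f) :=
    hfc.isCompact.image_of_continuousOn ((continuousOn_extChartAt x).mono hfx)
  refine contDiff_iff_contDiffAt.2 fun y => ?_
  by_cases hy : y ∈ (extChartAt (𝓡 n) x).target
  · exact ((contDiffAt_inChart hf x hy).congr_of_eventuallyEq (pullToChart_eventuallyEq hy f)).smul
      (hW y hy)
  · have hyK : y ∉ extChartAt (𝓡 n) x '' tsupport f := by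
      rintro ⟨z, hz, rfl⟩
      exact hy ((extChartAt (𝓡 n) x).map_source (hfx hz))
    refine (contDiffAt_const (c := (0 : V))).congr_of_eventuallyEq ?_
    filter_upwards [hK.isClosed.isOpen_compl.mem_nhds hyK] with z hz
    rw [pullToChart_eq_zero hz, zero_smul]

theorem hasCompactSupport_pullToChart_smul {x : M} {f : M → ℝ}
    (hfc : HasCompactSupport f) (hfx : tsupport f ⊆ (extChartAt (𝓡 n) x).source)
    {V : Type*} [NormedAddCommGroup V] [NormedSpace ℝ V] (W : RSpace n → V) :
    HasCompactSupport (fun y => pullToChart x f y • W y) := by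
  refine HasCompactSupport.intro
    (hfc.isCompact.image_of_continuousOn ((continuousOn_extChartAt x).mono hfx)) fun y hy => ?_
  rw [pullToChart_eq_zero hy, zero_smul]

variable [IsRiemannianManifold (𝓡 n) M] [SecondCountableTopology M]

/-- The energy estimate for a Lipschitz function multiplied by a smooth function supported in a
small chart domain. -/
theorem IsIsometricImmersion.integral_mul_le_of_chart (hF : IsIsometricImmersion F)
    (hT1 : ‖T‖ ≤ 1) (hT : ∀ p, normalPart F p T = meanCurvature F p)
    (hX : ∀ p, differential F p (X p) = T - normalPart F p T)
    {φ : M → ℝ} {L : ℝ≥0} (hφ : LipschitzWith L φ) {x : M} {r : ℝ} {C : ℝ≥0}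
    (hr : Metric.ball (extChartAt (𝓡 n) x x) r ⊆ (extChartAt (𝓡 n) x).target)
    (hC : LipschitzOnWith C (extChartAt (𝓡 n) x).symm (Metric.ball (extChartAt (𝓡 n) x x) r))
    {ρ : M → ℝ} (hρ : ContMDiff (𝓡 n) 𝓘(ℝ, ℝ) ∞ ρ) (hρ0 : ∀ p, 0 ≤ ρ p)
    (hρc : HasCompactSupport ρ) (hρx : tsupport ρ ⊆ (extChartAt (𝓡 n) x).source)
    (hρr : ∀ p ∈ tsupport ρ, extChartAt (𝓡 n) x p ∈ Metric.ball (extChartAt (𝓡 n) x x) r) :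
    ∫ p, φ p * (ρ p * ‖meanCurvature F p‖ ^ 2 + derivAlong X ρ p)
        ∂(areaMeasure F) ≤
      L * ∫ p, (tsupport φ).indicator ρ p ∂(areaMeasure F) := by
  set e := extChartAt (𝓡 n) x with he
  set K := e '' tsupport ρ with hKdef
  have hK : IsCompact K :=
    hρc.isCompact.image_of_continuousOn ((continuousOn_extChartAt x).mono hρx)
  have hKr : K ⊆ Metric.ball (e x) r := by
    rintro _ ⟨p, hp, rfl⟩
    exact hρr p hp
  set W := densityField (fderiv ℝ (inChart F x)) T with hWdef
  have hW : ∀ y ∈ e.target, ContDiffAt ℝ ∞ W y := fun y hy =>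
    contDiffAt_densityField (hF.contDiffAt_fderiv_inChart x hy)
      (hF.fderiv_inChart_injective x hy) T
  set V : RSpace n → RSpace n := fun y => pullToChart x ρ y • W y with hVdef
  have hV : ContDiff ℝ ∞ V := contDiff_pullToChart_smul hρ hρc hρx hW
  have hVc : HasCompactSupport V := hasCompactSupport_pullToChart_smul hρc hρx W
  have hV0 : ∀ y ∉ K, V =ᶠ[𝓝 y] fun _ => 0 := fun y hy => by
    filter_upwards [hK.isClosed.isOpen_compl.mem_nhds hy] with z hz
    simp only [hVdef, pullToChart_eq_zero hz, zero_smul]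
  -- In the chart `φ` is Lipschitz only on the ball. A Lipschitz extension to `ℝⁿ` changes nothing,
  -- since `V` vanishes off `K`, inside the ball. Its constant, depending on `C`, serves only
  -- integrability and does not enter the bound.
  obtain ⟨ψ, hψ, hψeq⟩ := (hφ.comp_lipschitzOnWith hC).extend_real
  have hibp := integral_mul_divergence hψ (hV.of_le (by simp)) hVc
  -- the integrands in the chart
  have hdiv : ∀ y ∈ e.target, divergence V y = areaDensity F x y *
      (ρ (e.symm y) * ‖meanCurvature F (e.symm y)‖ ^ 2 +
        derivAlong X ρ (e.symm y)) := fun y hy => by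
    have h1 : V =ᶠ[𝓝 y] fun z => (ρ ∘ e.symm) z • W z := by
      filter_upwards [pullToChart_eventuallyEq hy ρ] with z hz
      simp only [hVdef, hz]
      rfl
    rw [divergence_congr h1, divergence_smul
      ((contDiffAt_inChart hρ x hy).differentiableAt (by simp))
      ((hW y hy).differentiableAt (by simp)), hF.divergence_densityField hT x hy,
      hF.derivAlong_symm hX hρ x hy, hWdef, densityField, map_smul, smul_eq_mul]
    simp only [Function.comp_apply, areaDensity, gram_eq_gramMatrix, he]
    ring
  have hleft : ∫ p, φ p * (ρ p * ‖meanCurvature F p‖ ^ 2 + derivAlong X ρ p)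
      ∂(areaMeasure F) = ∫ y, ψ y * divergence V y := by
    have hcont : Continuous fun p =>
        φ p * (ρ p * ‖meanCurvature F p‖ ^ 2 + derivAlong X ρ p) := by
      have h1 := hF.continuous_normalPart T
      simp only [hT] at h1
      exact hφ.continuous.mul ((hρ.continuous.mul (h1.norm.pow 2)).add
        (hF.continuous_derivAlong hX hρ))
    rw [hF.integral_areaMeasure x hcont.aestronglyMeasurable, ← integral_indicator
      (measurableSet_target x)]
    · refine integral_congr_ae (ae_of_all _ fun y => ?_)
      beta_reduce
      have h0 : y ∉ K → divergence V y = 0 := fun hyK => by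
        rw [divergence_congr (hV0 y hyK)]
        simp [divergence]
      by_cases hy : y ∈ e.target
      · rw [Set.indicator_of_mem hy]
        have h1 := hdiv y hy
        by_cases hyK : y ∈ K
        · have hφψ : φ (e.symm y) = ψ y := hψeq (hKr hyK)
          rw [h1, ← hφψ, he]
          ring
        · rw [h0 hyK, he] at h1
          rw [mul_left_comm, ← h1, h0 hyK, mul_zero, mul_zero]
      · rw [Set.indicator_of_notMem hy, h0 fun h => hy (hr (hKr h)), mul_zero]
    · intro p hp
      have hps : p ∉ tsupport ρ := fun h => hp (hρx h)
      have h1 : ρ =ᶠ[𝓝 p] fun _ => 0 := notMem_tsupport_iff_eventuallyEq.1 hps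
      rw [derivAlong_congr h1, derivAlong_const, h1.self_of_nhds]
      simp
  -- the bound in the chart
  set b : RSpace n → ℝ := fun y => (e.symm ⁻¹' tsupport φ ∩ e.target).indicator
    (fun z => pullToChart x ρ z • areaDensity F x z) y with hbdef
  have hbi : Integrable b := by
    refine Integrable.indicator ?_ (measurableSet_symm_preimage_inter x
      (isClosed_tsupport φ).measurableSet)
    exact (contDiff_pullToChart_smul hρ hρc hρx fun y hy =>
      hF.contDiffAt_areaDensity x hy).continuous.integrable_of_hasCompactSupport
        (hasCompactSupport_pullToChart_smul hρc hρx _)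
  have hright : ∫ p, (tsupport φ).indicator ρ p ∂(areaMeasure F) = ∫ y, b y := by
    rw [hF.integral_areaMeasure x (hρ.continuous.aestronglyMeasurable.indicator
      (isClosed_tsupport φ).measurableSet), ← integral_indicator (measurableSet_target x)]
    · refine integral_congr_ae (ae_of_all _ fun y => ?_)
      simp only [hbdef]
      by_cases hy : y ∈ e.target
      · rw [Set.indicator_of_mem hy]
        by_cases hyφ : e.symm y ∈ tsupport φ
        · rw [Set.indicator_of_mem hyφ, Set.indicator_of_mem (show y ∈ e.symm ⁻¹' tsupport φ ∩ e.target from ⟨hyφ, hy⟩), pullToChart_of_mem hy,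
            smul_eq_mul, mul_comm]
        · rw [Set.indicator_of_notMem hyφ, Set.indicator_of_notMem fun h => hyφ h.1, mul_zero]
      · rw [Set.indicator_of_notMem hy, Set.indicator_of_notMem fun h => hy h.2]
    · intro p hp
      have h0 : ρ p = 0 := image_eq_zero_of_notMem_tsupport fun h => hp (hρx h)
      simp [h0]
  have hb0 : ∀ y, 0 ≤ b y := fun y => Set.indicator_nonneg (fun z _ => by
    rw [smul_eq_mul]
    exact mul_nonneg (Set.indicator_nonneg (fun _ _ => hρ0 _) _) (areaDensity_nonneg F x z)) y
  -- On the support of `φ` this is the gradient bound together with `|X| ≤ 1`. Off it `φ` vanishes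
  -- locally and so does its derivative.
  have hbound : ∀ᵐ y, -fderiv ℝ ψ y (V y) ≤ L * b y := by
    filter_upwards [hψ.ae_differentiableAt] with y hy
    by_cases hyK : y ∈ K
    · have hyt : y ∈ e.target := hr (hKr hyK)
      have heq : ψ =ᶠ[𝓝 y] φ ∘ e.symm := by
        filter_upwards [Metric.isOpen_ball.mem_nhds (hKr hyK)] with z hz
        exact (hψeq hz).symm
      have hd : DifferentiableAt ℝ (φ ∘ e.symm) y := hy.congr_of_eventuallyEq heq.symm
      have hVy : V y = (ρ (e.symm y) * areaDensity F x y) •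
          tangentCoeff (fderiv ℝ (inChart F x) y) T := by
        simp only [hVdef, hWdef, densityField, pullToChart_of_mem hyt, smul_smul]
        rfl
      rw [heq.fderiv_eq]
      by_cases hyφ : e.symm y ∈ tsupport φ
      · have hby : b y = ρ (e.symm y) * areaDensity F x y := by
          simp only [hbdef]
          rw [Set.indicator_of_mem (show y ∈ e.symm ⁻¹' tsupport φ ∩ e.target from
            ⟨hyφ, hyt⟩), pullToChart_of_mem hyt, smul_eq_mul]
        have h1 := (hF.abs_fderiv_comp_symm_le hφ x hyt hd
          (tangentCoeff (fderiv ℝ (inChart F x) y) T)).trans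
            (mul_le_mul_of_nonneg_left ((hF.norm_fderiv_tangentCoeff_le T x hyt).trans hT1)
              L.coe_nonneg)
        have h2 : 0 ≤ ρ (e.symm y) * areaDensity F x y :=
          mul_nonneg (hρ0 _) (areaDensity_nonneg F x y)
        rw [hVy, map_smul, smul_eq_mul, hby, ← mul_neg, mul_comm (L : ℝ)]
        refine mul_le_mul_of_nonneg_left ?_ h2
        rw [mul_one] at h1
        exact (neg_le_abs _).trans h1
      · have h1 : φ ∘ e.symm =ᶠ[𝓝 y] fun _ => 0 :=
          (continuousAt_extChartAt_symm'' hyt).eventually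
            (notMem_tsupport_iff_eventuallyEq.1 hyφ)
        rw [h1.fderiv_eq]
        simpa using mul_nonneg L.coe_nonneg (hb0 y)
    · rw [(hV0 y hyK).self_of_nhds, map_zero, neg_zero]
      exact mul_nonneg L.coe_nonneg (hb0 y)
  rw [hleft, hibp, hright, ← integral_neg, ← integral_const_mul]
  exact integral_mono_ae (integrable_fderiv_apply hψ hV.continuous hVc).neg (hbi.const_mul _) hbound

end ChartEstimate

/-! ### Globalization by a partition of unity. -/

section GlobalEstimate

open Filter Topology Manifold
open scoped NNReal ENNReal

variable {n : ℕ} {M : Type*} [EMetricSpace M] [ChartedSpace (RSpace n) M] [IsManifold (𝓡 n) ∞ M]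
  [RiemannianBundle (fun x : M => TangentSpace (𝓡 n) x)]

theorem derivAlong_add (X : ∀ p : M, TangentSpace (𝓡 n) p) {f g : M → ℝ} {p : M}
    (hf : MDifferentiableAt (𝓡 n) 𝓘(ℝ, ℝ) f p) (hg : MDifferentiableAt (𝓡 n) 𝓘(ℝ, ℝ) g p) :
    derivAlong X (fun q => f q + g q) p = derivAlong X f p + derivAlong X g p :=
  congrArg (fun D : TangentSpace (𝓡 n) p →L[ℝ] ℝ => D (X p)) (mfderiv_add hf hg)

theorem derivAlong_sum {ι : Type*} (X : ∀ p : M, TangentSpace (𝓡 n) p) (s : Finset ι)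
    {f : ι → M → ℝ} {p : M} (hf : ∀ i, ContMDiff (𝓡 n) 𝓘(ℝ, ℝ) ∞ (f i)) :
    derivAlong X (fun q => ∑ i ∈ s, f i q) p = ∑ i ∈ s, derivAlong X (f i) p := by
  classical
  induction s using Finset.induction_on with
  | empty => simpa using derivAlong_const X 0 p
  | insert i s hi ih =>
    simp only [Finset.sum_insert hi]
    rw [derivAlong_add X ((hf i).mdifferentiable (by simp) p)
      ((contMDiff_finsetSum fun j _ => hf j).mdifferentiable (by simp) p), ih]

variable [MeasurableSpace M] [BorelSpace M]
  {F : M → CSpace n} {T : CSpace n} [IsRiemannianManifold (𝓡 n) M] [SecondCountableTopology M]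

/-- On a translating soliton, the integral of `|H|²` against a compactly supported `L`-Lipschitz
function is at most `L` times the area of the support. -/
theorem IsIsometricImmersion.integral_mul_norm_meanCurvature_sq_le (hF : IsIsometricImmersion F)
    (hT1 : ‖T‖ ≤ 1) (hT : ∀ p, normalPart F p T = meanCurvature F p)
    [IsFiniteMeasureOnCompacts (areaMeasure F)]
    {φ : M → ℝ} {L : ℝ≥0} (hφ : LipschitzWith L φ) (hφc : HasCompactSupport φ) :
    ∫ p, φ p * ‖meanCurvature F p‖ ^ 2 ∂(areaMeasure F) ≤
      L * (areaMeasure F).real (tsupport φ) := by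
  have : LocallyCompactSpace M := Manifold.locallyCompact_of_finiteDimensional (𝓡 n)
  obtain ⟨X, hX⟩ := exists_differential_eq_sub_normalPart F T
  choose r hr0 hrt C hC using fun x : M => hF.exists_lipschitzOnWith_symm x
  set U : M → Set M := fun x => (extChartAt (𝓡 n) x).source ∩
    extChartAt (𝓡 n) x ⁻¹' Metric.ball (extChartAt (𝓡 n) x x) (r x) with hU
  have hUo : ∀ x, IsOpen (U x) := fun x => (continuousOn_extChartAt x).isOpen_inter_preimage
    (isOpen_extChartAt_source x) Metric.isOpen_ball
  obtain ⟨ρ, hρ⟩ := SmoothPartitionOfUnity.exists_isSubordinate (𝓡 n) isClosed_univ U hUo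
    fun x _ => Set.mem_iUnion.2 ⟨x, mem_extChartAt_source x, Metric.mem_ball_self (hr0 x)⟩
  have hρsm : ∀ i, ContMDiff (𝓡 n) 𝓘(ℝ, ℝ) ∞ (ρ i) := fun i => (ρ i).contMDiff
  have hρc : ∀ i, HasCompactSupport (ρ i) := fun i => by
    refine HasCompactSupport.of_support_subset_isCompact
      ((isCompact_closedBall (extChartAt (𝓡 n) i i) (r i)).image_of_continuousOn
        ((continuousOn_extChartAt_symm i).mono (hrt i))) fun p hp => ?_
    obtain ⟨hps, hpb⟩ := hρ i (subset_tsupport _ hp)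
    exact ⟨_, Metric.ball_subset_closedBall hpb, (extChartAt (𝓡 n) i).left_inv hps⟩
  -- By local finiteness and compactness finitely many `ρ i` matter. Their sum is 1 in a
  -- neighbourhood of each point of the support of `φ`, so the error terms `derivAlong X (ρ i)` add
  -- up to zero there.
  have hfin : {i | (tsupport (ρ i) ∩ tsupport φ).Nonempty}.Finite :=
    ρ.locallyFinite.closure.finite_nonempty_inter_compact hφc.isCompact
  set s := hfin.toFinset with hs
  have hsum : ∀ p ∈ tsupport φ, (fun q => ∑ i ∈ s, ρ i q) =ᶠ[𝓝 p] fun _ => 1 := by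
    intro p hp
    filter_upwards [ρ.eventually_finsupport_subset p] with q hq
    refine ρ.sum_finsupport' q (Set.mem_univ q) (hq.trans fun i hi => ?_)
    rw [hs, Set.Finite.mem_toFinset]
    exact ⟨p, (ρ.mem_fintsupport_iff p i).1 hi, hp⟩
  have hderiv : ∀ p ∈ tsupport φ, ∑ i ∈ s, derivAlong X (ρ i) p = 0 := fun p hp => by
    rw [← derivAlong_sum X s hρsm,
      derivAlong_congr (hsum p hp), derivAlong_const]
  have hHcont : Continuous fun p => ‖meanCurvature F p‖ ^ 2 := by
    have h1 := hF.continuous_normalPart T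
    simp only [hT] at h1
    exact h1.norm.pow 2
  have hint : ∀ i ∈ s, Integrable
      (fun p => φ p * (ρ i p * ‖meanCurvature F p‖ ^ 2 + derivAlong X (ρ i) p)) (areaMeasure F) :=
    fun i _ => (hφ.continuous.mul (((hρsm i).continuous.mul hHcont).add
      (hF.continuous_derivAlong hX (hρsm i)))).integrable_of_hasCompactSupport hφc.mul_right
  have hint' : ∀ i ∈ s, Integrable ((tsupport φ).indicator (ρ i)) (areaMeasure F) := fun i _ =>
    ((hρsm i).continuous.integrable_of_hasCompactSupport (hρc i)).indicator
      (isClosed_tsupport φ).measurableSet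
  calc ∫ p, φ p * ‖meanCurvature F p‖ ^ 2 ∂(areaMeasure F) =
      ∫ p, ∑ i ∈ s, φ p * (ρ i p * ‖meanCurvature F p‖ ^ 2 + derivAlong X (ρ i) p)
        ∂(areaMeasure F) := by
        refine integral_congr_ae (ae_of_all _ fun p => ?_)
        beta_reduce
        rw [← Finset.mul_sum, Finset.sum_add_distrib, ← Finset.sum_mul]
        by_cases hp : p ∈ tsupport φ
        · have h1 := (hsum p hp).self_of_nhds
          beta_reduce at h1
          rw [hderiv p hp, h1, one_mul, add_zero]
        · rw [image_eq_zero_of_notMem_tsupport hp, zero_mul, zero_mul]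
    _ = ∑ i ∈ s, ∫ p, φ p * (ρ i p * ‖meanCurvature F p‖ ^ 2 + derivAlong X (ρ i) p)
        ∂(areaMeasure F) := integral_finsetSum _ hint
    _ ≤ ∑ i ∈ s, L * ∫ p, (tsupport φ).indicator (ρ i) p ∂(areaMeasure F) :=
        Finset.sum_le_sum fun i _ => hF.integral_mul_le_of_chart hT1 hT hX hφ
          (Metric.ball_subset_closedBall.trans (hrt i)) (hC i) (hρsm i) (ρ.nonneg i) (hρc i)
          ((hρ i).trans Set.inter_subset_left) fun p hp => (hρ i hp).2
    _ = L * ∫ p, ∑ i ∈ s, (tsupport φ).indicator (ρ i) p ∂(areaMeasure F) := by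
        rw [← Finset.mul_sum, integral_finsetSum _ hint']
    _ = L * ∫ p, (tsupport φ).indicator (fun _ => (1 : ℝ)) p ∂(areaMeasure F) := by
        congr 1
        refine integral_congr_ae (ae_of_all _ fun p => ?_)
        beta_reduce
        by_cases hp : p ∈ tsupport φ
        · simp only [Set.indicator_of_mem hp]
          exact (hsum p hp).self_of_nhds
        · simp only [Set.indicator_of_notMem hp, Finset.sum_const_zero]
    _ = L * (areaMeasure F).real (tsupport φ) := by
        rw [integral_indicator_const _ (isClosed_tsupport φ).measurableSet, smul_eq_mul, mul_one]

end GlobalEstimate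

/-! ### Doubling of the area of geodesic balls. -/

section AreaGrowth

open Filter Topology Manifold Metric
open scoped NNReal ENNReal

/-- A positive sequence which at least doubles at each step is not polynomially bounded. -/
theorem not_forall_two_pow_mul_le {v A : ℝ} (hv : 0 < v) (n : ℕ) :
    ¬ ∀ k : ℕ, 1 ≤ k → 2 ^ k * v ≤ A * (k : ℝ) ^ n := by
  intro h
  have hlim : Tendsto (fun k : ℕ => A * ((k : ℝ) ^ n / 2 ^ k)) atTop (𝓝 (A * 0)) :=
    (tendsto_pow_const_div_const_pow_of_one_lt n one_lt_two).const_mul A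
  have hle : v ≤ A * 0 := by
    refine ge_of_tendsto hlim ?_
    filter_upwards [eventually_ge_atTop 1] with k hk
    rw [← mul_div_assoc, le_div_iff₀ (by positivity), mul_comm]
    exact h k hk
  linarith

variable {n : ℕ} {M : Type*} [EMetricSpace M] [ChartedSpace (RSpace n) M] [IsManifold (𝓡 n) ∞ M]
  [RiemannianBundle (fun x : M => TangentSpace (𝓡 n) x)] [MeasurableSpace M] [BorelSpace M]
  {F : M → CSpace n} {T : CSpace n} [IsRiemannianManifold (𝓡 n) M] [SecondCountableTopology M]

theorem EuclideanAreaGrowth.isFiniteMeasureOnCompacts (hArea : EuclideanAreaGrowth F)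
    (hF : Continuous F) : IsFiniteMeasureOnCompacts (areaMeasure F) := by
  obtain ⟨C, hC⟩ := hArea
  refine ⟨fun K hK => ?_⟩
  obtain ⟨R, hR⟩ := (hK.image hF).isBounded.subset_ball 0
  refine lt_of_le_of_lt (measure_mono fun p hp => ?_)
    (lt_of_le_of_lt (hC (max R 1) (le_max_right _ _)) ENNReal.ofReal_lt_top)
  exact ball_subset_ball (le_max_left _ _) (hR ⟨p, hp, rfl⟩)

/-- If `|H|² ≥ δ > 0` on a translating soliton, then the area of geodesic balls doubles whenever
the radius is increased by `2 / δ`. -/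
theorem IsIsometricImmersion.two_mul_area_closedEBall_le [CompleteSpace M]
    (hF : IsIsometricImmersion F) (hT1 : ‖T‖ ≤ 1)
    (hT : ∀ p, normalPart F p T = meanCurvature F p)
    [IsFiniteMeasureOnCompacts (areaMeasure F)] {δ : ℝ} (hδ : 0 < δ)
    (hH : ∀ p, δ ≤ ‖meanCurvature F p‖ ^ 2) (p : M) {r : ℝ} (hr : 0 ≤ r) :
    2 * (areaMeasure F).real (closedEBall p (ENNReal.ofReal r)) ≤
      (areaMeasure F).real (closedEBall p (ENNReal.ofReal (r + 2 / δ))) := by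
  set d := 2 / δ with hd
  have hd0 : 0 < d := by positivity
  set A := closedEBall p (ENNReal.ofReal r) with hA
  set B := closedEBall p (ENNReal.ofReal (r + d)) with hB
  have hBc : IsCompact B := isCompact_closedEBall n p (r + d)
  have hAc : IsCompact A := isCompact_closedEBall n p r
  -- A cutoff equal to 1 on `A` and 0 outside its `d`-thickening, with slope `1/d = δ/2`. This
  -- choice of `d` leaves the factor `δ / (δ/2) = 2`.
  set φ : M → ℝ := fun q => (thickenedIndicator hd0 A q : ℝ) with hφdef
  have hφ : LipschitzWith d.toNNReal⁻¹ φ := fun q q' =>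
    lipschitzWith_thickenedIndicator hd0 A q q'
  have hsupp : tsupport φ ⊆ B := by
    refine closure_minimal (fun q hq => ?_) isClosed_closedEBall
    have hq' : q ∈ thickening d A := by
      by_contra h
      exact hq (NNReal.coe_eq_zero.2 (thickenedIndicator_zero hd0 A h))
    rw [mem_thickening_iff_exists_edist_lt] at hq'
    obtain ⟨z, hz, hqz⟩ := hq'
    rw [hB, mem_closedEBall, add_comm, ENNReal.ofReal_add hd0.le hr]
    exact (edist_triangle q z p).trans (add_le_add hqz.le hz)
  have hφc : HasCompactSupport φ := hBc.of_isClosed_subset (isClosed_tsupport φ) hsupp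
  have hmain := hF.integral_mul_norm_meanCurvature_sq_le hT1 hT hφ hφc
  have hHcont : Continuous fun p => ‖meanCurvature F p‖ ^ 2 := by
    have h1 := hF.continuous_normalPart T
    simp only [hT] at h1
    exact h1.norm.pow 2
  have hlow : δ * (areaMeasure F).real A ≤
      ∫ q, φ q * ‖meanCurvature F q‖ ^ 2 ∂(areaMeasure F) := by
    have h1 : ∫ q, A.indicator (fun _ => δ) q ∂(areaMeasure F) = δ * (areaMeasure F).real A := by
      rw [integral_indicator_const _ hAc.isClosed.measurableSet, smul_eq_mul, mul_comm]
    rw [← h1]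
    refine integral_mono ((integrable_indicator_iff hAc.isClosed.measurableSet).2
      (integrableOn_const hAc.measure_lt_top.ne))
      ((hφ.continuous.mul hHcont).integrable_of_hasCompactSupport hφc.mul_right) fun q => ?_
    by_cases hq : q ∈ A
    · have : φ q = 1 := NNReal.coe_eq_one.2 (thickenedIndicator_one hd0 A hq)
      simpa [Set.indicator_of_mem hq, this] using hH q
    · rw [Set.indicator_of_notMem hq]
      exact mul_nonneg (NNReal.coe_nonneg _) (sq_nonneg _)
  have hup : (areaMeasure F).real (tsupport φ) ≤ (areaMeasure F).real B :=
    measureReal_mono hsupp hBc.measure_lt_top.ne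
  have hL : ((d.toNNReal⁻¹ : ℝ≥0) : ℝ) = δ / 2 := by
    rw [NNReal.coe_inv, Real.coe_toNNReal _ hd0.le, hd, inv_div]
  rw [hL] at hmain
  have := hlow.trans (hmain.trans (mul_le_mul_of_nonneg_left hup (by positivity)))
  have h2 : δ * (2 * (areaMeasure F).real A) ≤ δ * (areaMeasure F).real B := by linarith
  exact le_of_mul_le_mul_left h2 hδ

end AreaGrowth

end LagTranslator

end

/-! ### The contradiction between exponential and polynomial area growth. -/

open LagTranslator in
theorem theorem1p3 {n : ℕ} {M : Type*} [EMetricSpace M] [SecondCountableTopology M]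
    [ChartedSpace (RSpace n) M] [IsManifold (𝓡 n) ∞ M]
    [RiemannianBundle (fun x : M => TangentSpace (𝓡 n) x)]
    [IsContMDiffRiemannianBundle (𝓡 n) ∞ (RSpace n) (fun x : M => TangentSpace (𝓡 n) x)]
    [IsRiemannianManifold (𝓡 n) M] [CompleteSpace M] [Nonempty M]
    [MeasurableSpace M] [BorelSpace M]
    (F : M → CSpace n) (hF : IsIsometricImmersion F) (hLag : IsLagrangian F)
    (hMaslov : ZeroMaslovClass F) (hTrans : IsTranslatingSoliton F)
    (hArea : EuclideanAreaGrowth F) :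
    ⨅ x : M, ‖meanCurvature F x‖ ^ 2 = 0 := by
  obtain ⟨T, hT1, hT⟩ := hTrans
  have hfin := hArea.isFiniteMeasureOnCompacts hF.smooth.continuous
  obtain ⟨C, hC⟩ := hArea
  refine le_antisymm ?_ (Real.iInf_nonneg fun _ => sq_nonneg _)
  by_contra! hδ
  set δ := ⨅ x : M, ‖meanCurvature F x‖ ^ 2 with hδdef
  have hH : ∀ x, δ ≤ ‖meanCurvature F x‖ ^ 2 := fun x =>
    ciInf_le ⟨0, by rintro _ ⟨y, rfl⟩; exact sq_nonneg _⟩ x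
  obtain ⟨p⟩ := ‹Nonempty M›
  set d := 2 / δ with hd
  have hd0 : 0 < d := by positivity
  set V : ℝ → ℝ := fun r =>
    (LagTranslator.areaMeasure F).real (Metric.closedEBall p (ENNReal.ofReal r)) with hV
  have hgrow : ∀ k : ℕ, 2 ^ k * V 1 ≤ V (1 + k * d) := by
    intro k
    induction k with
    | zero => simp
    | succ k ih =>
      have h := hF.two_mul_area_closedEBall_le hT1.le hT hδ hH p
        (r := 1 + k * d) (by positivity)
      calc 2 ^ (k + 1) * V 1 = 2 * (2 ^ k * V 1) := by ring
        _ ≤ 2 * V (1 + k * d) := by linarith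
        _ ≤ V (1 + k * d + d) := h
        _ = V (1 + (k + 1 : ℕ) * d) := by
          congr 1
          push_cast
          ring
  have hpos : 0 < V 1 := by
    refine ENNReal.toReal_pos (ne_of_gt ?_) (isCompact_closedEBall n p 1).measure_lt_top.ne
    exact (hF.areaMeasure_pos (Metric.isOpen_eball (x := p) (ε := ENNReal.ofReal 1))
      (Metric.mem_eball_self (by simp))).trans_le (MeasureTheory.measure_mono
        Metric.eball_subset_closedEBall)
  -- The geodesic ball maps into the Euclidean ball about the origin, as `F` is 1-Lipschitz. The
  -- extra 1 makes that ball open and its radius at least 1, as the growth hypothesis requires.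
  have hupper : ∀ r : ℝ, 0 ≤ r → V r ≤ |C| * (r + ‖F p‖ + 1) ^ n := by
    intro r hr
    have hsub : Metric.closedEBall p (ENNReal.ofReal r) ⊆
        F ⁻¹' Metric.ball 0 (r + ‖F p‖ + 1) := fun q hq => by
      have h1 := (hF.lipschitzWith_one q p).trans (by simpa using hq)
      rw [edist_dist, ENNReal.ofReal_le_ofReal_iff hr, dist_eq_norm] at h1
      rw [Set.mem_preimage, mem_ball_zero_iff]
      have h2 := norm_le_norm_add_norm_sub (F p) (F q)
      rw [norm_sub_rev] at h2
      linarith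
    have h0 : 0 ≤ r + ‖F p‖ + 1 := by positivity
    have h := (MeasureTheory.measure_mono hsub).trans
      (hC (r + ‖F p‖ + 1) (by linarith [norm_nonneg (F p)]))
    refine (ENNReal.toReal_mono ENNReal.ofReal_ne_top
      (h.trans (ENNReal.ofReal_le_ofReal ?_))).trans (ENNReal.toReal_ofReal (by positivity)).le
    exact mul_le_mul_of_nonneg_right (le_abs_self C) (by positivity)
  -- For `k ≥ 1` the radius satisfies `(1 + k d) + ‖F p‖ + 1 ≤ (d + ‖F p‖ + 2) k`, which gives the
  -- constant.
  refine not_forall_two_pow_mul_le (A := |C| * (d + ‖F p‖ + 2) ^ n) hpos n fun k hk => ?_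
  have hk' : (1 : ℝ) ≤ k := by exact_mod_cast hk
  refine (hgrow k).trans ((hupper _ (by positivity)).trans ?_)
  rw [mul_assoc, ← mul_pow]
  gcongr
  nlinarith [norm_nonneg (F p)]
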